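/- Let $N\ge 2$ be an integer, let $b>0$ and $p>1+\frac{2b}{N-1}$ be real numbers, and, if $N\ge 3$, suppose in addition that $p<\frac{N+2+2b}{N-2}$. Let $H^1_r(\mathbb R^N)$ be the space of complex-valued radial functions in the Sobolev space $H^1(\mathbb R^N)$ (those that agree almost everywhere with a function of $|x|$), with the norm $\|f\|_{H^1}=(\|f\|_{L^2}^2+\|\nabla f\|_{L^2}^2)^{1/2}$. Then every $f\in H^1_r(\mathbb R^N)$ belongs to $L^{p+1}(\mathbb R^N,|x|^b\,dx)$, and the embedding $$H^1_r(\mathbb R^N)\hookrightarrow L^{p+1}(\mathbb R^N,|x|^b\,dx),\qquad f\mapsto f,$$ is continuous and compact. -/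

import Mathlib

open MeasureTheory
open scoped ENNReal ContDiff

noncomputable section

/-- `ℝ^N` with the Euclidean norm. -/
abbrev RN (N : ℕ) : Type := EuclideanSpace ℝ (Fin N)

/-- `ℂ^N` with the Hermitian norm, in which gradients of complex-valued functions take values. -/
abbrev CN (N : ℕ) : Type := EuclideanSpace ℂ (Fin N)

/-- The function `g ∈ L²(ℝ^N; ℂ^N)` is the weak gradient of `f ∈ L²(ℝ^N; ℂ)`:
`∫ f ∂ᵢφ dx = - ∫ gᵢ φ dx` for all `i` and all test functions `φ ∈ C_c^∞(ℝ^N)`. -/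
def IsWeakGradient {N : ℕ} (f : Lp ℂ 2 (volume : Measure (RN N)))
    (g : Lp (CN N) 2 (volume : Measure (RN N))) : Prop :=
  ∀ φ : RN N → ℝ, ContDiff ℝ ∞ φ → HasCompactSupport φ → ∀ i : Fin N,
    ∫ x, (fderiv ℝ φ x (EuclideanSpace.single i 1)) • f x = - ∫ x, φ x • (g x) i

/-- The class `f` has a representative that depends only on `|x|`. -/
def IsRadial {N : ℕ} (f : Lp ℂ 2 (volume : Measure (RN N))) : Prop :=
  ∃ h : ℝ → ℂ, f =ᵐ[volume] fun x => h ‖x‖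

/-- For a test function `φ` and `f ∈ L²`, the product `f ∂ᵢφ` is integrable. -/
theorem integrable_fderiv_smul {N : ℕ} (f : Lp ℂ 2 (volume : Measure (RN N)))
    {φ : RN N → ℝ} (h1 : ContDiff ℝ ∞ φ) (h2 : HasCompactSupport φ) (v : RN N) :
    Integrable (fun x => (fderiv ℝ φ x v) • f x) volume := by
  have hf : LocallyIntegrable f volume := (Lp.memLp f).locallyIntegrable (by norm_num)
  refine hf.integrable_smul_left_of_hasCompactSupport
    ((h1.continuous_fderiv (by simp)).clm_apply continuous_const) ?_
  exact h2.fderiv_apply (𝕜 := ℝ) v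

/-- For a test function `φ` and `g ∈ L²`, the product `gᵢ φ` is integrable. -/
theorem integrable_smul_coord {N : ℕ} (g : Lp (CN N) 2 (volume : Measure (RN N)))
    {φ : RN N → ℝ} (h1 : ContDiff ℝ ∞ φ) (h2 : HasCompactSupport φ) (i : Fin N) :
    Integrable (fun x => φ x • (g x) i) volume := by
  have hg : LocallyIntegrable g volume := (Lp.memLp g).locallyIntegrable (by norm_num)
  have h := hg.integrable_smul_left_of_hasCompactSupport h1.continuous h2
  simpa using ((EuclideanSpace.proj i : CN N →L[ℂ] ℂ).restrictScalars ℝ).integrable_comp h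

/-- The Sobolev space `H¹(ℝ^N)` of complex-valued functions, realized as the space of pairs
`(f, ∇f)` with `f ∈ L²`, weak gradient `∇f ∈ L²`, and the norm `(‖f‖²_{L²} + ‖∇f‖²_{L²})^{1/2}`.
The second component is determined by the first, weak gradients being unique. -/
def H1 (N : ℕ) : Submodule ℂ
    (WithLp 2 (Lp ℂ 2 (volume : Measure (RN N)) × Lp (CN N) 2 (volume : Measure (RN N)))) where
  carrier := {u | IsWeakGradient u.fst u.snd}
  zero_mem' := by
    intro φ _ _ i
    simp
  add_mem' := by
    intro u v hu hv φ h1 h2 i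
    have e1 : ∫ x, (fderiv ℝ φ x (EuclideanSpace.single i 1)) • (u.fst + v.fst) x =
        (∫ x, (fderiv ℝ φ x (EuclideanSpace.single i 1)) • u.fst x) +
          ∫ x, (fderiv ℝ φ x (EuclideanSpace.single i 1)) • v.fst x := by
      rw [← integral_add (integrable_fderiv_smul _ h1 h2 _) (integrable_fderiv_smul _ h1 h2 _)]
      refine integral_congr_ae ?_
      filter_upwards [Lp.coeFn_add u.fst v.fst] with x hx
      rw [hx, Pi.add_apply, smul_add]
    have e2 : ∫ x, φ x • ((u.snd + v.snd) x) i =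
        (∫ x, φ x • (u.snd x) i) + ∫ x, φ x • (v.snd x) i := by
      rw [← integral_add (integrable_smul_coord _ h1 h2 _) (integrable_smul_coord _ h1 h2 _)]
      refine integral_congr_ae ?_
      filter_upwards [Lp.coeFn_add u.snd v.snd] with x hx
      rw [hx, Pi.add_apply, PiLp.add_apply, smul_add]
    rw [WithLp.add_fst, WithLp.add_snd, e1, e2, hu φ h1 h2 i, hv φ h1 h2 i, neg_add]
  smul_mem' := by
    intro c u hu φ h1 h2 i
    have e1 : ∫ x, (fderiv ℝ φ x (EuclideanSpace.single i 1)) • (c • u.fst) x =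
        c • ∫ x, (fderiv ℝ φ x (EuclideanSpace.single i 1)) • u.fst x := by
      rw [← integral_smul]
      refine integral_congr_ae ?_
      filter_upwards [Lp.coeFn_smul c u.fst] with x hx
      rw [hx, Pi.smul_apply, smul_comm]
    have e2 : ∫ x, φ x • ((c • u.snd) x) i = c • ∫ x, φ x • (u.snd x) i := by
      rw [← integral_smul]
      refine integral_congr_ae ?_
      filter_upwards [Lp.coeFn_smul c u.snd] with x hx
      rw [hx, Pi.smul_apply, PiLp.smul_apply, smul_comm]
    rw [WithLp.smul_fst, WithLp.smul_snd, e1, e2, hu φ h1 h2 i, smul_neg]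

/-- The subspace `H¹_r(ℝ^N)` of radial functions in `H¹(ℝ^N)`, with the `H¹` norm. -/
def H1r (N : ℕ) : Submodule ℂ
    (WithLp 2 (Lp ℂ 2 (volume : Measure (RN N)) × Lp (CN N) 2 (volume : Measure (RN N)))) where
  carrier := {u | u ∈ H1 N ∧ IsRadial u.fst}
  zero_mem' := by
    refine ⟨(H1 N).zero_mem, fun _ => 0, ?_⟩
    exact Lp.coeFn_zero ℂ 2 (volume : Measure (RN N))
  add_mem' := by
    rintro u v ⟨hu, h, hh⟩ ⟨hv, k, hk⟩
    refine ⟨(H1 N).add_mem hu hv, fun r => h r + k r, ?_⟩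
    filter_upwards [Lp.coeFn_add u.fst v.fst, hh, hk] with x hx h1 h2
    rw [WithLp.add_fst, hx, Pi.add_apply, h1, h2]
  smul_mem' := by
    rintro c u ⟨hu, h, hh⟩
    refine ⟨(H1 N).smul_mem c hu, fun r => c • h r, ?_⟩
    filter_upwards [Lp.coeFn_smul c u.fst, hh] with x hx h1
    rw [WithLp.smul_fst, hx, Pi.smul_apply, h1]

/-- The measure `|x|^b dx` on `ℝ^N`. -/
def powerWeight (N : ℕ) (b : ℝ) : Measure (RN N) :=
  (volume : Measure (RN N)).withDensity fun x => ENNReal.ofReal (‖x‖ ^ b)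

/-- The exponent `p + 1` is at least `1`, so that `L^{p+1}` is a normed space. -/
instance fact_one_le_add_one (q : ℝ≥0∞) : Fact (1 ≤ q + 1) := ⟨le_add_self⟩

end

open Set Filter Topology

/-! Write a radial `f` as `h ‖x‖`. The weak gradient is tested against the radial field `η(|x|) x /
|x|^N`, whose divergence is `η'(|x|) / |x|^(N-1)`. In polar coordinates the Jacobian cancels and
Cauchy–Schwarz bounds `∫ η' h` by `‖∇f‖` times the square root of `∫ r^(1-N) dr` over the support of
`η` (`norm_integral_deriv_smul_le`). When `η` approximates the indicator of `[s, t]`, this becomes a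
bound for `h s - h t` at almost all radii (`exists_ae_norm_sub_le`).

Comparing `h s` with its `L²` mean over a unit interval then gives three pointwise bounds with
constant `C ‖u‖` (`exists_radialBounds`): growth at most `|x|^(-(N-2+δ)/2)` at the origin, decay
`|x|^(-(N-1)/2)` at infinity, and Hölder continuity of order `1/2` away from the origin.

For compactness, `f` is replaced by its means over finitely many thin shells in `r ≤ |x| < R`. This
is a finite-rank operator. In `L^q(|x|^b dx)`, `q = p + 1`, the error is small in operator norm:
near the origin because `p` is below the upper exponent, in the shells by Hölder continuity, and far
out because `p` exceeds the lower exponent and two powers of `f` are integrable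
(`eLpNorm_sub_shellAverage_le`). The inclusion is thus a norm limit of finite-rank operators. With
no shells at all, the same estimate is its boundedness. -/

/-! ### Smooth steps on the line, and increments from a distributional derivative -/

/-- The primitive of a normalized bump function, a smooth step from `0` to `1`. -/
noncomputable def bumpPrimitive (φ : ContDiffBump (0 : ℝ)) (r : ℝ) : ℝ :=
  ∫ y in Iic r, φ.normed volume y

theorem hasDerivAt_bumpPrimitive (φ : ContDiffBump (0 : ℝ)) (r : ℝ) :
    HasDerivAt (bumpPrimitive φ) (φ.normed volume r) r := by
  have hi : Integrable (φ.normed volume) volume := φ.integrable_normed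
  have h : bumpPrimitive φ = fun r => bumpPrimitive φ 0 + ∫ y in (0 : ℝ)..r, φ.normed volume y := by
    funext r
    rw [← intervalIntegral.integral_Iic_sub_Iic hi.integrableOn hi.integrableOn]
    simp [bumpPrimitive]
  rw [h]
  exact (intervalIntegral.integral_hasDerivAt_right (hi.intervalIntegrable)
    (φ.continuous_normed.stronglyMeasurableAtFilter _ _)
    φ.continuous_normed.continuousAt).const_add _

theorem contDiff_bumpPrimitive (φ : ContDiffBump (0 : ℝ)) : ContDiff ℝ ∞ (bumpPrimitive φ) := by
  rw [contDiff_infty_iff_deriv]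
  refine ⟨fun r => (hasDerivAt_bumpPrimitive φ r).differentiableAt, ?_⟩
  have : deriv (bumpPrimitive φ) = φ.normed volume :=
    funext fun r => (hasDerivAt_bumpPrimitive φ r).deriv
  rw [this]
  exact φ.contDiff_normed

theorem bumpPrimitive_nonneg (φ : ContDiffBump (0 : ℝ)) (r : ℝ) : 0 ≤ bumpPrimitive φ r :=
  integral_nonneg fun y => φ.nonneg_normed y

theorem bumpPrimitive_le_one (φ : ContDiffBump (0 : ℝ)) (r : ℝ) : bumpPrimitive φ r ≤ 1 := by
  rw [← φ.integral_normed (μ := volume)]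
  exact setIntegral_le_integral φ.integrable_normed (.of_forall fun y => φ.nonneg_normed y)

theorem normed_bump_eq_zero (φ : ContDiffBump (0 : ℝ)) {y : ℝ} (hy : φ.rOut ≤ |y|) :
    φ.normed volume y = 0 := by
  by_contra h
  have : y ∈ Function.support (φ.normed volume) := h
  rw [φ.support_normed_eq] at this
  simp at this
  linarith

theorem bumpPrimitive_of_le (φ : ContDiffBump (0 : ℝ)) {r : ℝ} (hr : r ≤ -φ.rOut) :
    bumpPrimitive φ r = 0 := by
  refine setIntegral_eq_zero_of_forall_eq_zero fun y hy => normed_bump_eq_zero φ ?_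
  have : y ≤ r := hy
  have := neg_le_abs y
  linarith

theorem bumpPrimitive_of_ge (φ : ContDiffBump (0 : ℝ)) {r : ℝ} (hr : φ.rOut ≤ r) :
    bumpPrimitive φ r = 1 := by
  rw [← φ.integral_normed (μ := volume)]
  refine setIntegral_eq_integral_of_forall_compl_eq_zero fun y hy => normed_bump_eq_zero φ ?_
  have : r < y := not_le.1 hy
  have := le_abs_self y
  linarith

/-- Bump functions on `ℝ` shrinking to the origin. -/
noncomputable def shrinkingBump (n : ℕ) : ContDiffBump (0 : ℝ) where
  rIn := 1 / (2 * ((n : ℝ) + 1))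
  rOut := 1 / ((n : ℝ) + 1)
  rIn_pos := by positivity
  rIn_lt_rOut := by
    apply one_div_lt_one_div_of_lt <;> linarith [n.cast_nonneg (α := ℝ)]

theorem tendsto_shrinkingBump_rOut : Tendsto (fun n => (shrinkingBump n).rOut) atTop (𝓝 0) :=
  tendsto_one_div_add_atTop_nhds_zero_nat

/-- Since `h` need not be integrable near `0`, Lebesgue differentiation is applied to its
truncations to an exhaustion of the half-line. Near a given `s > 0` a narrow bump sees only one
truncation. -/
theorem ae_tendsto_integral_bump_smul {h : ℝ → ℂ}
    (hh : ∀ a c : ℝ, 0 < a → IntegrableOn h (Ioo a c)) :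
    ∀ᵐ s : ℝ, 0 < s → Tendsto
      (fun n => ∫ y in Ioi (0 : ℝ), (shrinkingBump n).normed volume (y - s) • h y) atTop
      (𝓝 (h s)) := by
  have key : ∀ k : ℕ, ∀ᵐ s : ℝ, Tendsto (fun n => (convolution ((shrinkingBump n).normed volume)
      ((Ioo (1 / ((k : ℝ) + 1)) (k + 1)).indicator h) (ContinuousLinearMap.lsmul ℝ ℝ) volume) s)
      atTop (𝓝 ((Ioo (1 / ((k : ℝ) + 1)) (k + 1)).indicator h s)) := by
    intro k
    refine ContDiffBump.ae_convolution_tendsto_right_of_locallyIntegrable (K := 2)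
      tendsto_shrinkingBump_rOut (.of_forall fun n => ?_) ?_
    · simp only [shrinkingBump]
      field_simp
      rfl
    · exact ((hh _ _ (by positivity)).integrable_indicator measurableSet_Ioo).locallyIntegrable
  filter_upwards [ae_all_iff.2 key] with s hs hs0
  obtain ⟨k, hk⟩ : ∃ k : ℕ, 1 / ((k : ℝ) + 1) < s ∧ s < k + 1 := by
    obtain ⟨k1, hk1⟩ := exists_nat_one_div_lt hs0
    obtain ⟨k2, hk2⟩ := exists_nat_gt s
    refine ⟨max k1 k2, lt_of_le_of_lt ?_ hk1, ?_⟩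
    · apply one_div_le_one_div_of_le (by positivity)
      gcongr
      exact le_max_left _ _
    · push_cast
      linarith [le_max_right (k1 : ℝ) k2]
  have h1 := hs k
  rw [indicator_of_mem (mem_Ioo.2 hk)] at h1
  refine h1.congr' ?_
  have hd : 0 < min (s - 1 / ((k : ℝ) + 1)) (k + 1 - s) := lt_min (by linarith) (by linarith)
  filter_upwards [tendsto_shrinkingBump_rOut.eventually (gt_mem_nhds hd)] with n hn
  rw [convolution_eq_swap, ← integral_indicator measurableSet_Ioi]
  congr 1
  funext y
  rw [ContinuousLinearMap.lsmul_apply, show s - y = -(y - s) by ring, ContDiffBump.normed_neg]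
  have hk0 : (0 : ℝ) < 1 / ((k : ℝ) + 1) := by positivity
  by_cases hy : (shrinkingBump n).rOut ≤ |y - s|
  · rw [normed_bump_eq_zero _ hy]
    simp [indicator, normed_bump_eq_zero _ hy]
  · have h2 := abs_lt.1 ((not_le.1 hy).trans hn)
    have h3 := min_le_left (s - 1 / ((k : ℝ) + 1)) (k + 1 - s)
    have h4 := min_le_right (s - 1 / ((k : ℝ) + 1)) (k + 1 - s)
    rw [indicator_of_mem (mem_Ioo.2 ⟨by linarith, by linarith⟩),
      indicator_of_mem (mem_Ioi.2 (by linarith))]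

/-- A bound on the distributional derivative of `h`, tested against functions supported in
`[a, c]` and bounded by one, yields a bound on the increments of `h`. -/
theorem exists_ae_norm_sub_le {h : ℝ → ℂ} (hh : ∀ a c : ℝ, 0 < a → IntegrableOn h (Ioo a c)) :
    ∃ G : Set ℝ, (∀ᵐ s : ℝ, s ∈ G) ∧ ∀ W : ℝ → ℝ → ℝ,
    (∀ η : ℝ → ℝ, ContDiff ℝ ∞ η → ∀ a c : ℝ, 0 < a → a < c → (∀ r ≤ a, η r = 0) →
      (∀ r, c ≤ r → η r = 0) → (∀ r, |η r| ≤ 1) →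
      ‖∫ y in Ioi (0 : ℝ), deriv η y • h y‖ ≤ W a c) →
    ∀ s ∈ G, ∀ t ∈ G, 0 < s → s < t → ContinuousAt (Function.uncurry W) (s, t) →
      ‖h s - h t‖ ≤ W s t := by
  -- `G` is the set where the bump averages converge. It does not depend on `W`, so several moduli
  -- can later be used on the same set of radii.
  refine ⟨_, ae_tendsto_integral_bump_smul hh, ?_⟩
  intro W hW s hs t ht s0 hst hcont
  have hs' := hs s0
  have ht' := ht (s0.trans hst)
  have hr := tendsto_shrinkingBump_rOut
  have hlim : Tendsto (fun n => W (s - (shrinkingBump n).rOut) (t + (shrinkingBump n).rOut))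
      atTop (𝓝 (W s t)) := by
    have : Tendsto (fun n => (s - (shrinkingBump n).rOut, t + (shrinkingBump n).rOut)) atTop
        (𝓝 (s, t)) := by
      have h1 := (tendsto_const_nhds (x := s)).sub hr
      have h2 := (tendsto_const_nhds (x := t)).add hr
      rw [sub_zero] at h1
      rw [add_zero] at h2
      exact h1.prodMk_nhds h2
    exact hcont.tendsto.comp this
  refine le_of_tendsto_of_tendsto (hs'.sub ht').norm hlim ?_
  filter_upwards [hr.eventually (gt_mem_nhds s0)] with n hn
  set φ := shrinkingBump n
  have hpos := φ.rOut_pos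
  have hint : ∀ v : ℝ, 0 < v → φ.rOut < v →
      IntegrableOn (fun y => φ.normed volume (y - v) • h y) (Ioi 0) := by
    intro v hv hv'
    have h1 : IntegrableOn (fun y => φ.normed volume (y - v) • h y)
        (Icc (v - φ.rOut) (v + φ.rOut)) := by
      refine IntegrableOn.continuousOn_smul ?_ (Continuous.continuousOn
        (φ.continuous_normed.comp (continuous_sub_right v))) isCompact_Icc
      exact (hh ((v - φ.rOut) / 2) (v + φ.rOut + 1) (by linarith)).mono_set
        fun y hy => ⟨by linarith [hy.1], by linarith [hy.2]⟩
    refine IntegrableOn.mono_set (integrableOn_iff_integrable_of_support_subset ?_ |>.1 h1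
      |>.integrableOn (s := univ)) (subset_univ _)
    intro y hy
    by_contra hc
    refine hy ?_
    have : φ.rOut ≤ |y - v| := by
      by_contra hc'
      have := abs_lt.1 (not_le.1 hc')
      exact hc ⟨by linarith [this.1], by linarith [this.2]⟩
    simp [normed_bump_eq_zero _ this]
  rw [← integral_sub (hint s s0 hn) (hint t (s0.trans hst) (hn.trans hst))]
  have hder : ∀ y, HasDerivAt (fun r => bumpPrimitive φ (r - s) - bumpPrimitive φ (r - t))
      (φ.normed volume (y - s) - φ.normed volume (y - t)) y := fun y =>
    ((hasDerivAt_bumpPrimitive φ (y - s)).comp_sub_const y s).sub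
      ((hasDerivAt_bumpPrimitive φ (y - t)).comp_sub_const y t)
  -- This `η` rises from `0` to `1` around `s` and falls back around `t`; its derivative is the bump
  -- at `s` minus the bump at `t`.
  have := hW (fun r => bumpPrimitive φ (r - s) - bumpPrimitive φ (r - t)) ?_
    (s - φ.rOut) (t + φ.rOut) (by linarith) (by linarith) ?_ ?_ ?_
  · simpa only [(hder _).deriv, sub_smul] using this
  · exact ((contDiff_bumpPrimitive φ).comp (contDiff_id.sub contDiff_const)).sub
      ((contDiff_bumpPrimitive φ).comp (contDiff_id.sub contDiff_const))
  · intro r hr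
    rw [bumpPrimitive_of_le φ (by linarith), bumpPrimitive_of_le φ (by linarith), sub_zero]
  · intro r hr
    rw [bumpPrimitive_of_ge φ (by linarith), bumpPrimitive_of_ge φ (by linarith), sub_self]
  · intro r
    have h1 := bumpPrimitive_nonneg φ (r - s)
    have h2 := bumpPrimitive_nonneg φ (r - t)
    have h3 := bumpPrimitive_le_one φ (r - s)
    have h4 := bumpPrimitive_le_one φ (r - t)
    exact abs_le.2 ⟨by linarith, by linarith⟩

/-! ### `L²` norms and polar coordinates -/

theorem integral_norm_sq_eq_norm_sq {α E : Type*} [MeasurableSpace α] {μ : Measure α}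
    [NormedAddCommGroup E] (f : Lp E 2 μ) : ∫ x, ‖f x‖ ^ 2 ∂μ = ‖f‖ ^ 2 := by
  have h0 : 0 ≤ ∫ x, ‖f x‖ ^ 2 ∂μ := integral_nonneg fun x => by positivity
  rw [Lp.norm_def, (Lp.memLp f).eLpNorm_eq_integral_rpow_norm (by simp) (by simp)]
  simp only [ENNReal.toReal_ofNat, Real.rpow_two]
  rw [ENNReal.toReal_ofReal (by positivity), ← Real.rpow_natCast, ← Real.rpow_mul h0]
  norm_num

/-- The surface area of the unit sphere of `ℝ^N`. -/
noncomputable def sphereArea (N : ℕ) : ℝ :=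
  N * (volume : Measure (RN N)).real (Metric.ball 0 1)

theorem sphereArea_pos {N : ℕ} (hN : 1 ≤ N) : 0 < sphereArea N := by
  have : 0 < (volume : Measure (RN N)).real (Metric.ball 0 1) :=
    ENNReal.toReal_pos (Metric.measure_ball_pos _ _ one_pos).ne' measure_ball_lt_top.ne
  have : (0 : ℝ) < N := by exact_mod_cast hN
  unfold sphereArea
  positivity

theorem nontrivial_RN {N : ℕ} (hN : 1 ≤ N) : Nontrivial (RN N) := by
  have : Nonempty (Fin N) := ⟨⟨0, hN⟩⟩
  infer_instance

theorem integral_radial {N : ℕ} (hN : 1 ≤ N) {F : Type*} [NormedAddCommGroup F] [NormedSpace ℝ F]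
    (k : ℝ → F) :
    ∫ x : RN N, k ‖x‖ = sphereArea N • ∫ y in Ioi (0 : ℝ), y ^ (N - 1) • k y := by
  have := nontrivial_RN hN
  rw [integral_fun_norm_addHaar, finrank_euclideanSpace_fin, sphereArea, mul_smul,
    Nat.cast_smul_eq_nsmul]

theorem integrable_radial_iff {N : ℕ} (hN : 1 ≤ N) {F : Type*} [NormedAddCommGroup F]
    [NormedSpace ℝ F] {k : ℝ → F} :
    Integrable (fun x : RN N => k ‖x‖) ↔ IntegrableOn (fun y => y ^ (N - 1) • k y) (Ioi 0) := by
  have := nontrivial_RN hN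
  rw [integrable_fun_norm_addHaar, finrank_euclideanSpace_fin]

theorem ae_norm_mem {N : ℕ} (hN : 1 ≤ N) {G : Set ℝ} (hG : ∀ᵐ s : ℝ, s ∈ G) :
    ∀ᵐ x : RN N, ‖x‖ ∈ G := by
  classical
  have h0 : (fun y : ℝ => y ^ (N - 1) • Gᶜ.indicator (fun _ => (1 : ℝ)) y) =ᵐ[volume.restrict
      (Ioi 0)] fun _ => 0 := by
    filter_upwards [ae_restrict_of_ae hG] with y hy
    simp [hy]
  have h1 : Integrable (fun x : RN N => Gᶜ.indicator (fun _ => (1 : ℝ)) ‖x‖) :=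
    (integrable_radial_iff hN).2 ((integrable_zero _ _ _).congr h0.symm)
  have h2 : ∫ x : RN N, Gᶜ.indicator (fun _ => (1 : ℝ)) ‖x‖ = 0 := by
    rw [integral_radial hN, integral_congr_ae h0]
    simp
  rw [integral_eq_zero_iff_of_nonneg (fun x => indicator_nonneg (by simp) _) h1] at h2
  filter_upwards [h2] with x hx
  by_contra h
  simp [h] at hx

theorem ae_ne_zero {N : ℕ} (hN : 1 ≤ N) : ∀ᵐ x : RN N, x ≠ 0 := by
  have := nontrivial_RN hN
  exact compl_mem_ae_iff.2 (measure_singleton 0)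

/-! ### Testing the weak gradient against radial fields -/

/-- The `i`-th component of the radial vector field with flux `η (‖x‖)` through spheres. -/
noncomputable def radialField (N : ℕ) (η : ℝ → ℝ) (i : Fin N) (x : RN N) : ℝ :=
  η ‖x‖ / ‖x‖ ^ N * x i

section radialField

variable {N : ℕ} {η : ℝ → ℝ} {a c : ℝ}

theorem contDiffAt_radialProfile (hη : ContDiff ℝ ∞ η) {r : ℝ} (hr : 0 < r) :
    ContDiffAt ℝ ∞ (fun r => η r / r ^ N) r :=
  hη.contDiffAt.div (contDiffAt_id.pow N) (by positivity)

theorem contDiff_radialField (hη : ContDiff ℝ ∞ η) (ha : 0 < a) (h0 : ∀ r ≤ a, η r = 0)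
    (i : Fin N) : ContDiff ℝ ∞ (radialField N η i) := by
  rw [contDiff_iff_contDiffAt]
  intro x
  by_cases hx : x = 0
  · have : radialField N η i =ᶠ[𝓝 x] fun _ => 0 := by
      have hb : Metric.ball (0 : RN N) a ∈ 𝓝 x := by
        rw [hx]; exact Metric.ball_mem_nhds _ ha
      filter_upwards [hb] with y hy
      rw [mem_ball_zero_iff] at hy
      simp [radialField, h0 _ hy.le]
    exact contDiffAt_const.congr_of_eventuallyEq this
  · have h1 : ContDiffAt ℝ ∞ (fun x : RN N => η ‖x‖ / ‖x‖ ^ N) x :=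
      (contDiffAt_radialProfile hη (norm_pos_iff.2 hx)).comp x (contDiffAt_norm ℝ hx)
    exact h1.mul (EuclideanSpace.proj (𝕜 := ℝ) i).contDiff.contDiffAt

theorem hasCompactSupport_radialField (hc : ∀ r, c ≤ r → η r = 0) (i : Fin N) :
    HasCompactSupport (radialField N η i) := by
  refine HasCompactSupport.intro (isCompact_closedBall 0 c) fun x hx => ?_
  rw [mem_closedBall_zero_iff, not_le] at hx
  simp [radialField, hc _ hx.le]

/-- The field `x / |x|^N` is divergence free off the origin, so only the derivative of `η` survives.
-/
theorem sum_fderiv_radialField (hN : 1 ≤ N) (hη : ContDiff ℝ ∞ η) {x : RN N} (hx : x ≠ 0) :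
    ∑ i, fderiv ℝ (radialField N η i) x (EuclideanSpace.single i 1) =
      deriv η ‖x‖ / ‖x‖ ^ (N - 1) := by
  have hx' : 0 < ‖x‖ := norm_pos_iff.2 hx
  have hn : DifferentiableAt ℝ (fun y : RN N => ‖y‖) x :=
    (contDiffAt_norm ℝ hx (n := 1)).differentiableAt (by simp)
  have hψ : HasDerivAt (fun r => η r / r ^ N)
      ((deriv η ‖x‖ * ‖x‖ ^ N - η ‖x‖ * (N * ‖x‖ ^ (N - 1))) / (‖x‖ ^ N) ^ 2) ‖x‖ :=
    ((hη.differentiable (by simp)) _).hasDerivAt.div (hasDerivAt_pow N _) (by positivity)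
  set D := (deriv η ‖x‖ * ‖x‖ ^ N - η ‖x‖ * (N * ‖x‖ ^ (N - 1))) / (‖x‖ ^ N) ^ 2
  have hd : ∀ i : Fin N, fderiv ℝ (radialField N η i) x (EuclideanSpace.single i 1) =
      η ‖x‖ / ‖x‖ ^ N + D * (x i * fderiv ℝ (fun y : RN N => ‖y‖) x
        (EuclideanSpace.single i 1)) := by
    intro i
    have h1 := hψ.comp_hasFDerivAt x hn.hasFDerivAt
    have h2 := h1.mul (EuclideanSpace.proj (𝕜 := ℝ) i : RN N →L[ℝ] ℝ).hasFDerivAt (x := x)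
    have h3 : HasFDerivAt (radialField N η i) _ x := h2
    rw [h3.fderiv]
    simp
    ring
  -- Euler's identity for the norm, which is homogeneous of degree one.
  have hs : ∑ i, x i * fderiv ℝ (fun y : RN N => ‖y‖) x (EuclideanSpace.single i 1) = ‖x‖ := by
    have : fderiv ℝ (fun y : RN N => ‖y‖) x (∑ i, x i • EuclideanSpace.single i (1 : ℝ)) =
        ‖x‖ := by
      rw [← hn.fderiv_norm_self]
      congr 1
      simpa using (EuclideanSpace.basisFun (Fin N) ℝ).sum_repr x
    rw [← this, map_sum]
    simp
  simp only [hd]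
  rw [Finset.sum_add_distrib, ← Finset.mul_sum, hs]
  obtain ⟨m, rfl⟩ : ∃ m, N = m + 1 := ⟨N - 1, by omega⟩
  simp only [D, Finset.sum_const, Finset.card_univ, Fintype.card_fin, nsmul_eq_mul,
    Nat.add_sub_cancel]
  field_simp
  push_cast
  ring

end radialField

/-- For `0 < a < c`, the square root of `∫_a^c r^{1-N} dr` is at most `radialModulus N δ a c`. -/
noncomputable def radialModulus (N : ℕ) (δ a c : ℝ) : ℝ :=
  √(a ^ (-((N : ℝ) - 2 + δ)) * ((c ^ δ - a ^ δ) / δ))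

/-- Of the two factors `r^(1-N)` in the square, one is kept to cancel the Jacobian. The other is
split as `r^(-(N-2+δ)) r^(δ-1)`, with the first part frozen at `r = a`. The exponent `δ` avoids the
logarithm that `N = 2` would produce. -/
theorem radialField_sq_le {N : ℕ} (hN : 2 ≤ N) {η : ℝ → ℝ} {a c δ : ℝ} (ha : 0 < a)
    (h0 : ∀ r ≤ a, η r = 0) (hc : ∀ r, c ≤ r → η r = 0)
    (h1 : ∀ r, |η r| ≤ 1) (hδ : 0 < δ) (i : Fin N) (x : RN N) :
    ‖radialField N η i x‖ ^ 2 ≤ (Ioc a c).indicator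
      (fun r => a ^ (-((N : ℝ) - 2 + δ)) * r ^ (δ - 1) / r ^ (N - 1)) ‖x‖ := by
  by_cases hx : ‖x‖ ∈ Ioc a c
  · rw [indicator_of_mem hx]
    have hx0 : 0 < ‖x‖ := ha.trans hx.1
    have hxi : ‖x i‖ ≤ ‖x‖ := PiLp.norm_apply_le x i
    have e1 : ‖radialField N η i x‖ ≤ 1 / ‖x‖ ^ (N - 1) := by
      rw [radialField, norm_mul, norm_div, norm_pow, norm_norm]
      calc ‖η ‖x‖‖ / ‖x‖ ^ N * ‖x i‖ ≤ 1 / ‖x‖ ^ N * ‖x‖ := by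
            gcongr
            exact h1 _
        _ = 1 / ‖x‖ ^ (N - 1) := by
            obtain ⟨m, rfl⟩ : ∃ m, N = m + 1 := ⟨N - 1, by omega⟩
            simp only [Nat.add_sub_cancel]
            field_simp
            ring
    have e2 : 1 / ‖x‖ ^ (N - 1) ≤ a ^ (-((N : ℝ) - 2 + δ)) * ‖x‖ ^ (δ - 1) := by
      have hN' : (2 : ℝ) ≤ N := by exact_mod_cast hN
      calc 1 / ‖x‖ ^ (N - 1) = ‖x‖ ^ (-((N : ℝ) - 2 + δ)) * ‖x‖ ^ (δ - 1) := by
            rw [← Real.rpow_add hx0, ← Real.rpow_natCast, one_div, ← Real.rpow_neg hx0.le,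
              Nat.cast_sub (by omega)]
            congr 1
            push_cast
            ring
        _ ≤ _ := by
            gcongr ?_ * _
            exact Real.rpow_le_rpow_of_nonpos ha hx.1.le (by linarith)
    calc ‖radialField N η i x‖ ^ 2 ≤ (1 / ‖x‖ ^ (N - 1)) ^ 2 := by gcongr
      _ = 1 / ‖x‖ ^ (N - 1) / ‖x‖ ^ (N - 1) := by rw [sq]; field_simp
      _ ≤ _ := by gcongr
  · rw [indicator_of_notMem hx]
    have : η ‖x‖ = 0 := by
      by_cases h : ‖x‖ ≤ a
      · exact h0 _ h
      · exact hc _ (by by_contra h'; exact hx ⟨not_le.1 h, (not_le.1 h').le⟩)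
    simp [radialField, this]

theorem integral_radialField_sq_le {N : ℕ} (hN : 2 ≤ N) {η : ℝ → ℝ} {a c δ : ℝ}
    (ha : 0 < a) (hac : a < c) (h0 : ∀ r ≤ a, η r = 0) (hc : ∀ r, c ≤ r → η r = 0)
    (h1 : ∀ r, |η r| ≤ 1) (hδ : 0 < δ) (i : Fin N) :
    ∫ x, ‖radialField N η i x‖ ^ 2 ≤ sphereArea N * radialModulus N δ a c ^ 2 := by
  have hN1 : 1 ≤ N := by omega
  have hδ0 : a ^ δ ≤ c ^ δ := Real.rpow_le_rpow ha.le hac.le hδ.le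
  have e : EqOn (fun y : ℝ => y ^ (N - 1) • (Ioc a c).indicator
      (fun r => a ^ (-((N : ℝ) - 2 + δ)) * r ^ (δ - 1) / r ^ (N - 1)) y)
      ((Ioc a c).indicator fun r => a ^ (-((N : ℝ) - 2 + δ)) * r ^ (δ - 1)) (Ioi 0) := by
    intro y hy
    have hy : 0 < y := hy
    by_cases h : y ∈ Ioc a c
    · simp only [indicator_of_mem h, smul_eq_mul]
      field_simp
    · simp only [indicator_of_notMem h, smul_zero]
  have hii : IntervalIntegrable (fun r : ℝ => a ^ (-((N : ℝ) - 2 + δ)) * r ^ (δ - 1))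
      volume a c := (intervalIntegral.intervalIntegrable_rpow' (by linarith)).const_mul _
  have hint : Integrable (fun x : RN N => (Ioc a c).indicator
      (fun r => a ^ (-((N : ℝ) - 2 + δ)) * r ^ (δ - 1) / r ^ (N - 1)) ‖x‖) := by
    rw [integrable_radial_iff hN1, integrableOn_congr_fun e measurableSet_Ioi]
    refine (IntegrableOn.integrable_indicator ?_ measurableSet_Ioc).integrableOn
    exact (intervalIntegrable_iff_integrableOn_Ioc_of_le hac.le).1 hii
  refine (integral_mono_of_nonneg (.of_forall fun x => by positivity) hint
    (.of_forall (radialField_sq_le hN ha h0 hc h1 hδ i))).trans (le_of_eq ?_)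
  rw [integral_radial hN1, setIntegral_congr_fun measurableSet_Ioi e,
    setIntegral_indicator measurableSet_Ioc, inter_eq_right.2 (fun y hy => mem_Ioi.2 (ha.trans hy.1)),
    ← intervalIntegral.integral_of_le hac.le, intervalIntegral.integral_const_mul,
    integral_rpow (Or.inl (by linarith)), radialModulus, Real.sq_sqrt, smul_eq_mul]
  · simp
  · have := sub_nonneg.2 hδ0
    positivity

theorem norm_integral_mul_coord_le {N : ℕ} {φ : RN N → ℝ} (hφ : Continuous φ)
    (hs : HasCompactSupport φ) (g : Lp (CN N) 2 (volume : Measure (RN N))) (i : Fin N) :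
    ‖∫ x, φ x • (g x) i‖ ≤ √(∫ x, ‖φ x‖ ^ 2) * ‖g‖ := by
  have h2 : ENNReal.ofReal 2 = 2 := by simp
  have hm : MemLp φ (ENNReal.ofReal 2) := hφ.memLp_of_hasCompactSupport hs
  have hg : MemLp g (ENNReal.ofReal 2) := by rw [h2]; exact Lp.memLp g
  have hl : Integrable (fun x => ‖φ x‖ * ‖g x‖) := by
    have := (hm.norm.mul' (p := ENNReal.ofReal 2) (q := ENNReal.ofReal 2) (r := 1) hg.norm
      (hpqr := by rw [h2]; infer_instance))
    rw [memLp_one_iff_integrable] at this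
    refine this.congr (.of_forall fun x => ?_)
    simp [mul_comm]
  calc ‖∫ x, φ x • (g x) i‖ ≤ ∫ x, ‖φ x‖ * ‖g x‖ := by
        refine norm_integral_le_of_norm_le hl (.of_forall fun x => ?_)
        rw [norm_smul]
        gcongr
        exact PiLp.norm_apply_le (g x) i
    _ ≤ (∫ x, ‖φ x‖ ^ (2 : ℝ)) ^ (1 / 2 : ℝ) * (∫ x, ‖g x‖ ^ (2 : ℝ)) ^ (1 / 2 : ℝ) := by
        simpa using integral_mul_norm_le_Lp_mul_Lq Real.HolderConjugate.two_two hm hg.norm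
    _ = _ := by
        simp only [Real.rpow_two, ← Real.sqrt_eq_rpow]
        rw [integral_norm_sq_eq_norm_sq, Real.sqrt_sq (norm_nonneg _)]

/-- The radial derivative of a radial `H¹` function, tested against `η`. -/
theorem norm_integral_deriv_smul_le {N : ℕ} (hN : 2 ≤ N)
    {f : Lp ℂ 2 (volume : Measure (RN N))} {g : Lp (CN N) 2 (volume : Measure (RN N))}
    (hfg : IsWeakGradient f g) {h : ℝ → ℂ} (hf : f =ᵐ[volume] fun x => h ‖x‖)
    {η : ℝ → ℝ} {a c δ : ℝ} (hη : ContDiff ℝ ∞ η)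
    (ha : 0 < a) (hac : a < c) (h0 : ∀ r ≤ a, η r = 0) (hc : ∀ r, c ≤ r → η r = 0)
    (h1 : ∀ r, |η r| ≤ 1) (hδ : 0 < δ) :
    ‖∫ y in Ioi (0 : ℝ), deriv η y • h y‖ ≤
      N / √(sphereArea N) * ‖g‖ * radialModulus N δ a c := by
  have hN1 : 1 ≤ N := by omega
  have hA := sphereArea_pos hN1
  have hsm := fun i : Fin N => contDiff_radialField hη ha h0 i
  have hcs := fun i : Fin N => hasCompactSupport_radialField (N := N) hc i
  have e1 : ∑ i, ∫ x, fderiv ℝ (radialField N η i) x (EuclideanSpace.single i 1) • f x =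
      sphereArea N • ∫ y in Ioi (0 : ℝ), deriv η y • h y := by
    rw [← integral_finsetSum _ fun i _ => integrable_fderiv_smul f (hsm i) (hcs i) _]
    have : (fun x => ∑ i, fderiv ℝ (radialField N η i) x (EuclideanSpace.single i 1) • f x)
        =ᵐ[volume] fun x => (fun r => (deriv η r / r ^ (N - 1)) • h r) ‖x‖ := by
      filter_upwards [hf, ae_ne_zero hN1] with x hx hx0
      rw [← Finset.sum_smul, sum_fderiv_radialField hN1 hη hx0, hx]
    rw [integral_congr_ae this, integral_radial hN1 fun r => (deriv η r / r ^ (N - 1)) • h r]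
    congr 1
    refine setIntegral_congr_fun measurableSet_Ioi fun y hy => ?_
    have hy : 0 < y := hy
    simp only [smul_smul]
    congr 1
    field_simp
  -- Cauchy–Schwarz is applied to each component separately, which costs the factor `N`.
  have e2 : ‖sphereArea N • ∫ y in Ioi (0 : ℝ), deriv η y • h y‖ ≤
      N * (√(sphereArea N) * radialModulus N δ a c * ‖g‖) := by
    rw [← e1]
    refine (norm_sum_le _ _).trans ?_
    have : ∀ i ∈ Finset.univ, ‖∫ x, fderiv ℝ (radialField N η i) x (EuclideanSpace.single i 1) •
        f x‖ ≤ √(sphereArea N) * radialModulus N δ a c * ‖g‖ := by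
      intro i _
      rw [hfg _ (hsm i) (hcs i) i, norm_neg]
      refine (norm_integral_mul_coord_le (hsm i).continuous (hcs i) g i).trans ?_
      gcongr
      rw [← Real.sqrt_sq (show 0 ≤ radialModulus N δ a c from Real.sqrt_nonneg _), ← Real.sqrt_mul hA.le]
      exact Real.sqrt_le_sqrt (integral_radialField_sq_le hN ha hac h0 hc h1 hδ i)
    refine (Finset.sum_le_sum this).trans (le_of_eq ?_)
    simp
  rw [norm_smul, Real.norm_of_nonneg hA.le] at e2
  have hsq := Real.mul_self_sqrt hA.le
  have hs := Real.sqrt_pos.2 hA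
  rw [div_mul_eq_mul_div, div_mul_eq_mul_div, le_div_iff₀ hs]
  refine le_of_mul_le_mul_left ?_ hs
  linear_combination e2 + ‖∫ y in Ioi (0 : ℝ), deriv η y • h y‖ * hsq

/-! ### Pointwise bounds for radial `H¹` functions -/

section radialProfile

variable {N : ℕ} {f : Lp ℂ 2 (volume : Measure (RN N))} {h : ℝ → ℂ}

/-- Away from the origin the Jacobian `y^(N-1)` is bounded below and can be divided out. -/
theorem integrableOn_radialProfile (hN : 1 ≤ N) (hf : f =ᵐ[volume] fun x => h ‖x‖) (a c : ℝ)
    (ha : 0 < a) : IntegrableOn h (Ioo a c) := by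
  have := nontrivial_RN hN
  have h1 : IntegrableOn (fun x : RN N => h ‖x‖) (Metric.ball 0 (c + 1)) :=
    (((Lp.memLp f).locallyIntegrable (by norm_num)).integrableOn_isCompact
      (isCompact_closedBall 0 (c + 1))).mono_set Metric.ball_subset_closedBall |>.congr
      (ae_restrict_of_ae hf)
  rw [integrableOn_fun_norm_addHaar, finrank_euclideanSpace_fin] at h1
  have h2 : IntegrableOn (fun y : ℝ => y ^ (N - 1) • h y) (Icc a c) :=
    h1.mono_set fun y hy => ⟨ha.trans_le hy.1, by linarith [hy.2]⟩
  have h3 : IntegrableOn (fun y : ℝ => (y ^ (N - 1))⁻¹ • (y ^ (N - 1) • h y)) (Icc a c) := by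
    refine h2.continuousOn_smul ?_ isCompact_Icc
    exact (continuousOn_pow _).inv₀ fun y hy => (pow_pos (ha.trans_le hy.1) _).ne'
  refine (h3.congr_fun (fun y hy => ?_) measurableSet_Icc).mono_set Ioo_subset_Icc_self
  have : 0 < y ^ (N - 1) := pow_pos (ha.trans_le hy.1) _
  simp only [smul_smul, inv_mul_cancel₀ this.ne', one_smul]

theorem integrableOn_radialProfile_sq (hN : 1 ≤ N) (hf : f =ᵐ[volume] fun x => h ‖x‖) :
    IntegrableOn (fun y => y ^ (N - 1) * ‖h y‖ ^ 2) (Ioi 0) := by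
  have h1 : Integrable (fun x : RN N => (fun r => ‖h r‖ ^ 2) ‖x‖) := by
    refine ((memLp_two_iff_integrable_sq_norm (Lp.aestronglyMeasurable f)).1 (Lp.memLp f)).congr ?_
    filter_upwards [hf] with x hx
    rw [hx]
  exact (integrable_radial_iff hN (k := fun r => ‖h r‖ ^ 2)).1 h1

theorem integral_radialProfile_sq (hN : 1 ≤ N) (hf : f =ᵐ[volume] fun x => h ‖x‖) :
    ∫ y in Ioi (0 : ℝ), y ^ (N - 1) * ‖h y‖ ^ 2 = ‖f‖ ^ 2 / sphereArea N := by
  have hA := sphereArea_pos hN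
  have h1 : ∫ x, ‖f x‖ ^ 2 = ∫ x : RN N, (fun r => ‖h r‖ ^ 2) ‖x‖ := by
    refine integral_congr_ae ?_
    filter_upwards [hf] with x hx
    rw [hx]
  rw [integral_norm_sq_eq_norm_sq, integral_radial hN fun r => ‖h r‖ ^ 2] at h1
  rw [h1, smul_eq_mul, mul_div_cancel_left₀ _ hA.ne']
  rfl

/-- Integrate `‖h s‖² ≤ 2 ‖h t‖² + 2 B²` over `t` in an interval of length one; there `t^(N-1) ≥
m^(N-1)`, so the `L²` norm of `f` controls the first term. -/
theorem norm_sq_le_of_ae_norm_sub_le (hN : 1 ≤ N) (hf : f =ᵐ[volume] fun x => h ‖x‖)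
    {s m B : ℝ} (hm : 0 < m) (hB : ∀ᵐ t : ℝ, t ∈ Ioc m (m + 1) → ‖h s - h t‖ ≤ B) :
    ‖h s‖ ^ 2 ≤ 2 * (‖f‖ ^ 2 / sphereArea N / m ^ (N - 1)) + 2 * B ^ 2 := by
  have hi := integrableOn_radialProfile_sq hN hf
  have hsub : Ioc m (m + 1) ⊆ Ioi 0 := fun y hy => hm.trans hy.1
  have h1 : ∫ t in Ioc m (m + 1), (‖h s‖ ^ 2 - 2 * B ^ 2) ≤
      ∫ t in Ioc m (m + 1), 2 / m ^ (N - 1) * (t ^ (N - 1) * ‖h t‖ ^ 2) := by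
    refine setIntegral_mono_on_ae (integrableOn_const (by simp))
      ((hi.mono_set hsub).const_mul _) measurableSet_Ioc ?_
    filter_upwards [hB] with t ht htm
    have e1 : ‖h s‖ ≤ ‖h t‖ + B := by
      have := norm_sub_norm_le (h s) (h t)
      linarith [ht htm]
    have e2 : ‖h s‖ ^ 2 ≤ (‖h t‖ + B) ^ 2 := by gcongr
    have e3 : m ^ (N - 1) ≤ t ^ (N - 1) := by
      gcongr
      exact htm.1.le
    have e4 : 2 * ‖h t‖ ^ 2 ≤ 2 / m ^ (N - 1) * (t ^ (N - 1) * ‖h t‖ ^ 2) := by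
      rw [div_mul_eq_mul_div, le_div_iff₀ (by positivity), mul_assoc]
      rw [mul_comm (t ^ (N - 1))]
      gcongr
    nlinarith [sq_nonneg (‖h t‖ - B)]
  have h2 : ∫ t in Ioc m (m + 1), 2 / m ^ (N - 1) * (t ^ (N - 1) * ‖h t‖ ^ 2) ≤
      2 / m ^ (N - 1) * (‖f‖ ^ 2 / sphereArea N) := by
    rw [integral_const_mul, ← integral_radialProfile_sq hN hf]
    refine mul_le_mul_of_nonneg_left ?_ (by positivity)
    refine setIntegral_mono_set hi ?_ hsub.eventuallyLE
    filter_upwards [ae_restrict_mem measurableSet_Ioi] with y hy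
    have : 0 < y := hy
    simp only [Pi.zero_apply]
    positivity
  have h3 := h1.trans h2
  simp at h3
  have e : 2 / m ^ (N - 1) * (‖f‖ ^ 2 / sphereArea N) =
    2 * (‖f‖ ^ 2 / sphereArea N / m ^ (N - 1)) := by ring
  linarith

end radialProfile

theorem continuousAt_radialModulus {N : ℕ} {δ s t : ℝ} (hs : 0 < s) (ht : 0 < t) :
    ContinuousAt (Function.uncurry (radialModulus N δ)) (s, t) := by
  have h1 : ContinuousAt (fun q : ℝ × ℝ => q.1 ^ (-((N : ℝ) - 2 + δ))) (s, t) :=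
    continuousAt_fst.rpow_const (Or.inl hs.ne')
  have h2 : ContinuousAt (fun q : ℝ × ℝ => q.1 ^ δ) (s, t) :=
    continuousAt_fst.rpow_const (Or.inl hs.ne')
  have h3 : ContinuousAt (fun q : ℝ × ℝ => q.2 ^ δ) (s, t) :=
    continuousAt_snd.rpow_const (Or.inl ht.ne')
  exact Real.continuous_sqrt.continuousAt.comp (h1.mul ((h3.sub h2).div_const δ))

/-- Pointwise bounds for a radial function `f` of `H¹` norm at most `A`: near the origin, at
infinity, and for its increments. -/
structure RadialBounds {N : ℕ} (f : RN N → ℂ) (A α : ℝ) (S : Set (RN N)) : Prop where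
  ne_zero : ∀ x ∈ S, x ≠ 0
  near : ∀ x ∈ S, ‖x‖ < 1 → ‖f x‖ ≤ A * ‖x‖ ^ (-α)
  far : ∀ x ∈ S, 1 ≤ ‖x‖ → ‖f x‖ ≤ A * ‖x‖ ^ (-(((N : ℝ) - 1) / 2))
  sub : ∀ x ∈ S, ∀ y ∈ S, ‖x‖ ≤ ‖y‖ →
    ‖f x - f y‖ ≤ A * ‖x‖ ^ (-(((N : ℝ) - 1) / 2)) * √(‖y‖ - ‖x‖)

theorem le_of_sq_le_mul_rpow {v C S s β : ℝ} (hC : 0 ≤ C) (hS : 0 ≤ S) (hs : 0 < s)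
    (h : v ^ 2 ≤ C ^ 2 * S ^ 2 * s ^ (-(2 * β))) : v ≤ C * S * s ^ (-β) := by
  refine le_of_sq_le_sq ?_ (by positivity)
  rw [mul_pow, mul_pow, ← Real.rpow_natCast (s ^ (-β)), ← Real.rpow_mul hs.le,
    show -β * ((2 : ℕ) : ℝ) = -(2 * β) by push_cast; ring]
  exact h

theorem exists_radialBounds {N : ℕ} (hN : 2 ≤ N) {δ : ℝ} (hδ : 0 < δ) :
    ∃ C : ℝ, 0 < C ∧ ∀ u ∈ H1r N, ∃ S : Set (RN N), (∀ᵐ x, x ∈ S) ∧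
      RadialBounds u.fst (C * ‖u‖) (((N : ℝ) - 2 + δ) / 2) S := by
  have hN1 : 1 ≤ N := by omega
  have hN' : (2 : ℝ) ≤ N := by exact_mod_cast hN
  have hA := sphereArea_pos hN1
  set K : ℝ := N / √(sphereArea N) with hK
  have hK0 : 0 ≤ K := by positivity
  -- The term `2 / sphereArea N` comes from the `L²` mean and `2^δ / δ` from the modulus near the
  -- origin. The summand `1` serves the far bound and ensures `K ≤ √C2`.
  set C2 : ℝ := 2 / sphereArea N + 2 * K ^ 2 * (1 + 2 ^ δ / δ) with hC2
  have hC2pos : 0 < C2 := by positivity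
  have hsq : √C2 ^ 2 = C2 := Real.sq_sqrt hC2pos.le
  refine ⟨√C2, Real.sqrt_pos.2 hC2pos, ?_⟩
  rintro u ⟨hu, h, hh⟩
  have hnorm := WithLp.prod_norm_sq_eq_of_L2 u
  have hf2 : ‖u.fst‖ ^ 2 ≤ ‖u‖ ^ 2 := by linarith [sq_nonneg ‖u.snd‖]
  have hg2 : ‖u.snd‖ ^ 2 ≤ ‖u‖ ^ 2 := by linarith [sq_nonneg ‖u.fst‖]
  have hg : ‖u.snd‖ ≤ ‖u‖ := le_of_sq_le_sq hg2 (norm_nonneg _)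
  obtain ⟨G, hG, hGW⟩ := exists_ae_norm_sub_le (integrableOn_radialProfile hN1 hh)
  have hmod : ∀ ε : ℝ, 0 < ε → ∀ s ∈ G, ∀ t ∈ G, 0 < s → s < t →
      ‖h s - h t‖ ≤ K * ‖u‖ * radialModulus N ε s t := by
    intro ε hε s hs t ht hs0 hst
    refine (hGW (fun a c => K * ‖u.snd‖ * radialModulus N ε a c) ?_ s hs t ht hs0 hst ?_).trans ?_
    · intro η hη a c ha hac h0 hc h1
      exact norm_integral_deriv_smul_le hN hu hh hη ha hac h0 hc h1 hε
    · exact continuousAt_const.mul (continuousAt_radialModulus hs0 (hs0.trans hst))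
    · have : 0 ≤ radialModulus N ε s t := Real.sqrt_nonneg _
      gcongr
  -- Compare with the radii in `(1, 2]`, where the Jacobian is at least one.
  have hnear : ∀ s ∈ G, 0 < s → s < 1 →
      ‖h s‖ ≤ √C2 * ‖u‖ * s ^ (-(((N : ℝ) - 2 + δ) / 2)) := by
    intro s hs hs0 hs1
    refine le_of_sq_le_mul_rpow (Real.sqrt_nonneg _) (norm_nonneg _) hs0 ?_
    rw [mul_div_cancel₀ _ two_ne_zero, hsq]
    set w := s ^ (-((N : ℝ) - 2 + δ)) with hw
    have hw1 : 1 ≤ w := Real.one_le_rpow_of_pos_of_le_one_of_nonpos hs0 hs1.le (by linarith)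
    have hB := norm_sq_le_of_ae_norm_sub_le hN1 hh (s := s) (m := 1)
      (B := K * ‖u‖ * √(w * (2 ^ δ / δ))) one_pos (by
        filter_upwards [hG] with t ht htm
        refine (hmod δ hδ s hs t ht hs0 (hs1.trans htm.1)).trans ?_
        unfold radialModulus
        gcongr
        have h1 : t ^ δ ≤ 2 ^ δ :=
          Real.rpow_le_rpow (by linarith [htm.1]) (by linarith [htm.2]) hδ.le
        have h2 := Real.rpow_nonneg hs0.le δ
        linarith)
    rw [mul_pow, Real.sq_sqrt (by positivity), one_pow, div_one] at hB
    calc ‖h s‖ ^ 2 ≤ _ := hB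
      _ ≤ 2 * (‖u‖ ^ 2 / sphereArea N) * w + 2 * ((K * ‖u‖) ^ 2 * (w * (1 + 2 ^ δ / δ))) := by
          have h1 : ‖u.fst‖ ^ 2 / sphereArea N ≤ ‖u‖ ^ 2 / sphereArea N := by gcongr
          have h2 : ‖u‖ ^ 2 / sphereArea N ≤ ‖u‖ ^ 2 / sphereArea N * w :=
            le_mul_of_one_le_right (by positivity) hw1
          have h3 : w * (2 ^ δ / δ) ≤ w * (1 + 2 ^ δ / δ) := by gcongr; linarith
          have h4 := mul_le_mul_of_nonneg_left h3 (sq_nonneg (K * ‖u‖))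
          linarith
      _ = C2 * ‖u‖ ^ 2 * w := by rw [hC2]; ring
  -- The choice `δ = 1` gives the modulus behind both the decay at infinity and the Hölder bound.
  have hone : ∀ s t : ℝ, radialModulus N 1 s t = √(s ^ (-((N : ℝ) - 1)) * (t - s)) := by
    intro s t
    simp only [radialModulus, Real.rpow_one, div_one]
    congr 3
    ring
  -- Compare with the radii in `(s, s + 1]`: the `L²` mean and the modulus both contribute
  -- `s^(-(N-1))`.
  have hfar : ∀ s ∈ G, 1 ≤ s → ‖h s‖ ≤ √C2 * ‖u‖ * s ^ (-(((N : ℝ) - 1) / 2)) := by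
    intro s hs hs1
    have hs0 : 0 < s := by linarith
    refine le_of_sq_le_mul_rpow (Real.sqrt_nonneg _) (norm_nonneg _) hs0 ?_
    rw [mul_div_cancel₀ _ two_ne_zero, hsq]
    set w := s ^ (-((N : ℝ) - 1)) with hw
    have hw0 : 0 < w := Real.rpow_pos_of_pos hs0 _
    have hwN : 1 / s ^ (N - 1) = w := by
      rw [hw, Real.rpow_neg hs0.le, one_div, ← Real.rpow_natCast, Nat.cast_sub hN1, Nat.cast_one]
    have hB := norm_sq_le_of_ae_norm_sub_le hN1 hh (s := s) (m := s)
      (B := K * ‖u‖ * √w) hs0 (by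
        filter_upwards [hG] with t ht htm
        refine (hmod 1 one_pos s hs t ht hs0 htm.1).trans ?_
        rw [hone]
        gcongr
        exact mul_le_of_le_one_right hw0.le (by linarith [htm.2]))
    rw [mul_pow, Real.sq_sqrt hw0.le, div_eq_mul_one_div _ (s ^ (N - 1)), hwN] at hB
    calc ‖h s‖ ^ 2 ≤ _ := hB
      _ ≤ 2 * (‖u‖ ^ 2 / sphereArea N * w) + 2 * ((K * ‖u‖) ^ 2 * (w * (1 + 2 ^ δ / δ))) := by
          have h3 : w ≤ w * (1 + 2 ^ δ / δ) := by
            refine le_mul_of_one_le_right hw0.le ?_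
            have : 0 ≤ (2 : ℝ) ^ δ / δ := by positivity
            linarith
          gcongr
      _ = C2 * ‖u‖ ^ 2 * w := by rw [hC2]; ring
  have hKC : K ≤ √C2 := by
    refine Real.le_sqrt_of_sq_le ?_
    have h1 : 0 ≤ K ^ 2 * ((2 : ℝ) ^ δ / δ) := by positivity
    have h2 : 0 ≤ 2 / sphereArea N := by positivity
    rw [hC2]
    nlinarith [sq_nonneg K]
  have hsub : ∀ s ∈ G, ∀ t ∈ G, 0 < s → s ≤ t →
      ‖h s - h t‖ ≤ √C2 * ‖u‖ * s ^ (-(((N : ℝ) - 1) / 2)) * √(t - s) := by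
    intro s hs t ht hs0 hst
    rcases hst.eq_or_lt with rfl | hst
    · simp
    refine (hmod 1 one_pos s hs t ht hs0 hst).trans ?_
    rw [hone, Real.sqrt_mul (by positivity), ← mul_assoc, Real.sqrt_eq_rpow,
      ← Real.rpow_mul hs0.le, show -((N : ℝ) - 1) * (1 / 2) = -(((N : ℝ) - 1) / 2) by ring]
    gcongr
  refine ⟨{x | u.fst x = h ‖x‖ ∧ ‖x‖ ∈ G ∧ x ≠ 0}, ?_, ?_, ?_, ?_, ?_⟩
  · filter_upwards [hh, ae_norm_mem hN1 hG, ae_ne_zero hN1] with x h1 h2 h3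
    exact ⟨h1, h2, h3⟩
  · exact fun x hx => hx.2.2
  · rintro x ⟨h1, h2, h3⟩ hx
    rw [h1]
    exact hnear _ h2 (norm_pos_iff.2 h3) hx
  · rintro x ⟨h1, h2, h3⟩ hx
    rw [h1]
    exact hfar _ h2 hx
  · rintro x ⟨h1, h2, h3⟩ y ⟨h4, h5, h6⟩ hxy
    rw [h1, h4]
    exact hsub _ h2 _ h5 (norm_pos_iff.2 h3) hxy

/-! ### The weighted measure -/

section powerWeight

variable {N : ℕ} {b : ℝ}

theorem measurable_powerDensity : Measurable fun x : RN N => ENNReal.ofReal (‖x‖ ^ b) := by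
  fun_prop

/-- The density is positive off the origin, itself a null set. -/
theorem ae_powerWeight_iff (hN : 1 ≤ N) {P : RN N → Prop} :
    (∀ᵐ x ∂powerWeight N b, P x) ↔ ∀ᵐ x, P x := by
  refine ⟨fun h => ?_, fun h => ?_⟩
  · refine (withDensity_absolutelyContinuous' measurable_powerDensity.aemeasurable ?_).ae_le h
    filter_upwards [ae_ne_zero hN] with x hx
    have : 0 < ‖x‖ ^ b := Real.rpow_pos_of_pos (norm_pos_iff.2 hx) _
    simpa using this
  · exact (withDensity_absolutelyContinuous _ _).ae_le h

theorem powerWeight_lt_top_of_subset_ball (hb : 0 ≤ b) {s : Set (RN N)} {R : ℝ}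
    (hs : s ⊆ Metric.ball 0 R) : powerWeight N b s < ⊤ := by
  refine (measure_mono hs).trans_lt ?_
  rw [powerWeight, withDensity_apply _ Metric.isOpen_ball.measurableSet]
  refine setLIntegral_lt_top_of_le_nnreal measure_ball_lt_top.ne ⟨Real.toNNReal (R ^ b), ?_⟩
  intro x hx
  rw [mem_ball_zero_iff] at hx
  exact ENNReal.ofReal_le_ofReal (by gcongr)

/-- A pointwise integrable bound for `|x|^b |F|^q` controls the weighted `L^q` norm. -/
theorem eLpNorm_powerWeight_le {F : RN N → ℂ} {B : RN N → ℝ} {q : ℝ≥0∞} (hq0 : q ≠ 0)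
    (hq : q ≠ ⊤) (hFB : ∀ᵐ x, ‖x‖ ^ b * ‖F x‖ ^ q.toReal ≤ B x) (hB : Integrable B) {T : ℝ}
    (hT : 0 ≤ T) (hBT : ∫ x, B x ≤ T ^ q.toReal) :
    eLpNorm F q (powerWeight N b) ≤ ENNReal.ofReal T := by
  have hq' : 0 < q.toReal := ENNReal.toReal_pos hq0 hq
  rw [eLpNorm_eq_lintegral_rpow_enorm_toReal hq0 hq, one_div, ENNReal.rpow_inv_le_iff hq',
    ENNReal.ofReal_rpow_of_nonneg hT hq'.le]
  refine le_trans ?_ (ENNReal.ofReal_le_ofReal hBT)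
  have hB0 : 0 ≤ᵐ[volume] B := by
    filter_upwards [hFB] with x hx
    exact le_trans (by positivity) hx
  rw [ofReal_integral_eq_lintegral_ofReal hB hB0, powerWeight,
    lintegral_withDensity_eq_lintegral_mul_non_measurable _ measurable_powerDensity
      (.of_forall fun x => ENNReal.ofReal_lt_top)]
  refine lintegral_mono_ae ?_
  filter_upwards [hFB] with x hx
  rw [Pi.mul_apply, ← ofReal_norm, ENNReal.ofReal_rpow_of_nonneg (norm_nonneg _) hq'.le,
    ← ENNReal.ofReal_mul (by positivity)]
  exact ENNReal.ofReal_le_ofReal hx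

end powerWeight

/-! ### Averages over spherical shells -/

/-- The `j`-th spherical shell of thickness `m`, counted from radius `r`. -/
def shell (N : ℕ) (r m : ℝ) (j : ℕ) : Set (RN N) :=
  {x | r + j * m ≤ ‖x‖ ∧ ‖x‖ < r + (j + 1) * m}

/-- The function equal to the mean of `f` on each of the first `n` shells, and to `0` elsewhere. -/
noncomputable def shellAverage {N : ℕ} (r m : ℝ) (n : ℕ) (f : RN N → ℂ) (x : RN N) : ℂ :=
  ∑ j ∈ Finset.range n, (shell N r m j).indicator (fun _ => ⨍ y in shell N r m j, f y) x

section shell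

variable {N : ℕ} {r m : ℝ}

theorem measurableSet_shell (j : ℕ) : MeasurableSet (shell N r m j) :=
  (measurableSet_le measurable_const measurable_norm).inter
    (measurableSet_lt measurable_norm measurable_const)

theorem shell_subset_ball (j : ℕ) : shell N r m j ⊆ Metric.ball 0 (r + (j + 1) * m) :=
  fun _ hx => mem_ball_zero_iff.2 hx.2

theorem volume_shell_lt_top (j : ℕ) : volume (shell N r m j) < ⊤ :=
  (measure_mono (shell_subset_ball j)).trans_lt measure_ball_lt_top

theorem pos_of_mem_shell {j : ℕ} {x : RN N} (hx : x ∈ shell N r m j) : 0 < m := by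
  have := hx.1.trans_lt hx.2
  linarith

theorem eq_of_mem_shell {j k : ℕ} {x : RN N} (hj : x ∈ shell N r m j) (hk : x ∈ shell N r m k) :
    j = k := by
  have hm := pos_of_mem_shell hj
  have key : ∀ {j k : ℕ}, x ∈ shell N r m j → x ∈ shell N r m k → j ≤ k := by
    intro j k hj hk
    have h1 : (j : ℝ) * m < (k + 1) * m := by linarith [hj.1, hk.2]
    have h2 : (j : ℝ) < k + 1 := lt_of_mul_lt_mul_right h1 hm.le
    exact Nat.lt_succ_iff.1 (by exact_mod_cast h2)
  exact le_antisymm (key hj hk) (key hk hj)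

theorem exists_mem_shell {n : ℕ} {x : RN N} (h1 : r ≤ ‖x‖) (h2 : ‖x‖ < r + n * m) :
    ∃ j < n, x ∈ shell N r m j := by
  induction n with
  | zero => simp at h2; linarith
  | succ n ih =>
    by_cases h : ‖x‖ < r + n * m
    · obtain ⟨j, hj, hx⟩ := ih h
      exact ⟨j, by omega, hx⟩
    · refine ⟨n, by omega, not_lt.1 h, ?_⟩
      push_cast at h2
      exact h2

theorem shellAverage_of_mem {n j : ℕ} {f : RN N → ℂ} {x : RN N} (hj : j < n)
    (hx : x ∈ shell N r m j) : shellAverage r m n f x = ⨍ y in shell N r m j, f y := by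
  rw [shellAverage, Finset.sum_eq_single_of_mem j (Finset.mem_range.2 hj), indicator_of_mem hx]
  intro k _ hk
  exact indicator_of_notMem (fun h => hk (eq_of_mem_shell h hx)) _

theorem shellAverage_of_lt {n : ℕ} {f : RN N → ℂ} {x : RN N} (hm : 0 ≤ m) (hx : ‖x‖ < r) :
    shellAverage r m n f x = 0 := by
  refine Finset.sum_eq_zero fun j _ => indicator_of_notMem (fun h => ?_) _
  have := h.1
  have : 0 ≤ (j : ℝ) * m := by positivity
  linarith

theorem shellAverage_of_ge {n : ℕ} {f : RN N → ℂ} {x : RN N} (hm : 0 ≤ m)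
    (hx : r + n * m ≤ ‖x‖) : shellAverage r m n f x = 0 := by
  refine Finset.sum_eq_zero fun j hj => indicator_of_notMem (fun h => ?_) _
  have h2 := h.2
  have h3 : ((j : ℝ) + 1) * m ≤ n * m := by
    gcongr
    exact_mod_cast Finset.mem_range.1 hj
  linarith

theorem RadialBounds.norm_sub_le_of_mem_shell {f : RN N → ℂ} {A α : ℝ} {S : Set (RN N)}
    (h : RadialBounds f A α S) (hN : 1 ≤ N) (hA : 0 ≤ A) (hr : 0 < r) {j : ℕ} {x y : RN N}
    (hxS : x ∈ S) (hyS : y ∈ S) (hx : x ∈ shell N r m j) (hy : y ∈ shell N r m j) :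
    ‖f x - f y‖ ≤ A * r ^ (-(((N : ℝ) - 1) / 2)) * √m := by
  have hm := pos_of_mem_shell hx
  wlog hxy : ‖x‖ ≤ ‖y‖ generalizing x y
  · rw [norm_sub_rev]
    exact this hyS hxS hy hx (not_le.1 hxy).le
  refine (h.sub x hxS y hyS hxy).trans ?_
  have hN' : (1 : ℝ) ≤ N := by exact_mod_cast hN
  have hrx : r ≤ ‖x‖ := by
    have : 0 ≤ (j : ℝ) * m := by positivity
    linarith [hx.1]
  gcongr A * ?_ * √?_
  · exact Real.rpow_le_rpow_of_nonpos hr hrx (by linarith)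
  · linarith [hx.1, hy.2]

/-- The difference is the mean over `y` of `f x - f y`, and radii in one shell are at least `r` and
differ by at most `m`. A null shell, whose mean is a default value, is handled first. -/
theorem RadialBounds.ae_norm_sub_average_le {f : RN N → ℂ} {A α : ℝ} {S : Set (RN N)}
    (h : RadialBounds f A α S) (hS : ∀ᵐ x, x ∈ S) (hf : LocallyIntegrable f)
    (hN : 1 ≤ N) (hA : 0 ≤ A) (hr : 0 < r) (j : ℕ) :
    ∀ᵐ x, x ∈ shell N r m j →
      ‖f x - ⨍ y in shell N r m j, f y‖ ≤ A * r ^ (-(((N : ℝ) - 1) / 2)) * √m := by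
  by_cases h0 : volume (shell N r m j) = 0
  · filter_upwards [measure_eq_zero_iff_ae_notMem.1 h0] with x hx hx'
    exact absurd hx' hx
  have hfin := volume_shell_lt_top (N := N) (r := r) (m := m) j
  have hpos : 0 < volume.real (shell N r m j) := ENNReal.toReal_pos h0 hfin.ne
  have hint : IntegrableOn f (shell N r m j) :=
    (hf.integrableOn_isCompact (isCompact_closedBall 0 _)).mono_set
      ((shell_subset_ball j).trans Metric.ball_subset_closedBall)
  filter_upwards [hS] with x hxS hx
  have hconst : IntegrableOn (fun _ => f x) (shell N r m j) := integrableOn_const hfin.ne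
  have e1 : f x - ⨍ y in shell N r m j, f y =
      (volume.real (shell N r m j))⁻¹ • ∫ y in shell N r m j, (f x - f y) := by
    rw [integral_sub hconst hint, setIntegral_const, smul_sub, smul_smul,
      inv_mul_cancel₀ hpos.ne', one_smul, setAverage_eq]
  have e2 : ‖∫ y in shell N r m j, (f x - f y)‖ ≤
      A * r ^ (-(((N : ℝ) - 1) / 2)) * √m * volume.real (shell N r m j) := by
    refine norm_setIntegral_le_of_norm_le_const_ae' hfin ?_
    filter_upwards [hS] with y hyS hy
    exact h.norm_sub_le_of_mem_shell hN hA hr hxS hyS hx hy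
  rw [e1, norm_smul, norm_inv, Real.norm_of_nonneg hpos.le, inv_mul_le_iff₀ hpos,
    mul_comm _ (A * _ * _)]
  exact e2

end shell

/-! ### The error of shell averaging -/

theorem integrableOn_ball_norm_rpow {N : ℕ} (hN : 1 ≤ N) {κ : ℝ} (hκ : 0 < κ) :
    IntegrableOn (fun x : RN N => ‖x‖ ^ (κ - N)) (Metric.ball 0 1) := by
  have := nontrivial_RN hN
  rw [integrableOn_fun_norm_addHaar volume (f := fun r : ℝ => r ^ (κ - N)),
    finrank_euclideanSpace_fin]
  have h : IntegrableOn (fun y : ℝ => y ^ (κ - 1)) (Ioo 0 1) :=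
    (intervalIntegral.integrableOn_Ioo_rpow_iff one_pos).2 (by linarith)
  refine h.congr_fun (fun y hy => ?_) measurableSet_Ioo
  simp only [smul_eq_mul]
  rw [← Real.rpow_natCast, ← Real.rpow_add hy.1, Nat.cast_sub hN]
  congr 1
  push_cast
  ring

/-- An upper bound for the `q`-th power of the distance in `L^q(|x|^b dx)` between a radial function
of `H¹` norm one and its averages over `n` shells of thickness `m`, counted from radius `r`. -/
noncomputable def shellError (N : ℕ) (b q C κ θ r m : ℝ) (n : ℕ) : ℝ :=
  C ^ q * (r ^ κ * (∫ x in Metric.ball (0 : RN N) 1, ‖x‖ ^ (κ - N)) +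
    (r ^ (-(((N : ℝ) - 1) / 2)) * √m) ^ q * (r + n * m) ^ b *
      volume.real (Metric.ball (0 : RN N) (r + n * m))) + C ^ (q - 2) * (r + n * m) ^ (-θ)

theorem shellError_nonneg {N : ℕ} {b q C κ θ r m : ℝ} {n : ℕ} (hC : 0 ≤ C) (hr : 0 ≤ r)
    (hm : 0 ≤ m) : 0 ≤ shellError N b q C κ θ r m n := by
  have : 0 ≤ ∫ x in Metric.ball (0 : RN N) 1, ‖x‖ ^ (κ - N) :=
    integral_nonneg fun x => by positivity
  unfold shellError
  positivity

/-- Far from the origin, `q - 2` powers of `v` are spent on the decay, which beats the weight by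
`t^(-θ)`; the other two are left for the `L²` norm. -/
theorem rpow_mul_rpow_neg_le {b θ A R t v q β : ℝ} (hA : 0 ≤ A) (hR : 0 < R) (ht : R ≤ t)
    (hv : 0 ≤ v) (hq : 2 < q) (hθ : 0 ≤ θ) (hβ : β * (q - 2) = b + θ) (h : v ≤ A * t ^ (-β)) :
    t ^ b * v ^ q ≤ A ^ (q - 2) * R ^ (-θ) * v ^ 2 := by
  have ht0 : 0 < t := hR.trans_le ht
  have e1 : v ^ q = v ^ (q - 2) * v ^ 2 := by
    rcases hv.eq_or_lt with rfl | hv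
    · rw [Real.zero_rpow (by linarith)]
      simp
    · rw [← Real.rpow_natCast v 2, ← Real.rpow_add hv]
      norm_num
  have e2 : v ^ (q - 2) ≤ A ^ (q - 2) * t ^ (-(b + θ)) := by
    refine (Real.rpow_le_rpow hv h (by linarith)).trans (le_of_eq ?_)
    rw [Real.mul_rpow hA (by positivity), ← Real.rpow_mul ht0.le, neg_mul, hβ]
  have e3 : t ^ b * t ^ (-(b + θ)) = t ^ (-θ) := by
    rw [← Real.rpow_add ht0]
    congr 1
    ring
  have e4 : t ^ (-θ) ≤ R ^ (-θ) := Real.rpow_le_rpow_of_nonpos hR ht (by linarith)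
  calc t ^ b * v ^ q = t ^ b * v ^ (q - 2) * v ^ 2 := by rw [e1]; ring
    _ ≤ t ^ b * (A ^ (q - 2) * t ^ (-(b + θ))) * v ^ 2 := by gcongr
    _ = A ^ (q - 2) * (t ^ b * t ^ (-(b + θ))) * v ^ 2 := by ring
    _ ≤ _ := by rw [e3]; gcongr

/-- The spare exponent `2 κ` is halved: one half yields the small factor `r^κ`, the other keeps
`t^(κ-ν)` integrable at the origin in dimension `ν`. -/
theorem rpow_mul_rpow_near_le {b A r t v q α κ ν : ℝ} (hA : 0 ≤ A) (ht : 0 < t) (htr : t ≤ r)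
    (hv : 0 ≤ v) (hq : 0 ≤ q) (hκ : 0 ≤ κ) (hα : b - α * q = 2 * κ - ν) (h : v ≤ A * t ^ (-α)) :
    t ^ b * v ^ q ≤ A ^ q * (r ^ κ * t ^ (κ - ν)) := by
  calc t ^ b * v ^ q ≤ t ^ b * (A * t ^ (-α)) ^ q := by gcongr
    _ = A ^ q * (t ^ b * t ^ (-α * q)) := by
        rw [Real.mul_rpow hA (by positivity), ← Real.rpow_mul ht.le]
        ring
    _ = A ^ q * (t ^ κ * t ^ (κ - ν)) := by
        rw [← Real.rpow_add ht, ← Real.rpow_add ht]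
        congr 2
        linarith
    _ ≤ _ := by gcongr

theorem eLpNorm_sub_shellAverage_le {N : ℕ} (hN : 2 ≤ N) {b C α κ θ σ : ℝ} {q : ℝ≥0∞}
    (hb : 0 < b) (hq : q ≠ ⊤) (hq2 : 2 < q.toReal) (hκ : 0 < κ) (hθ : 0 < θ)
    (hα : b - α * q.toReal = 2 * κ - N) (hβ : ((N : ℝ) - 1) / 2 * (q.toReal - 2) = b + θ)
    (hC : 0 ≤ C) (hσ : 0 ≤ σ) {f : Lp ℂ 2 (volume : Measure (RN N))} (hfσ : ‖f‖ ≤ σ)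
    {S : Set (RN N)} (hS : ∀ᵐ x, x ∈ S) (h : RadialBounds f (C * σ) α S) {r m : ℝ} {n : ℕ}
    (hr : 0 < r) (hr1 : r ≤ 1) (hm : 0 ≤ m) (hR : 1 ≤ r + n * m) :
    eLpNorm (fun x => f x - shellAverage r m n f x) q (powerWeight N b) ≤
      ENNReal.ofReal (shellError N b q.toReal C κ θ r m n ^ (1 / q.toReal) * σ) := by
  have hN1 : 1 ≤ N := by omega
  have hq0 : q ≠ 0 := by rintro rfl; simp at hq2; linarith
  set Q := q.toReal with hQ
  set R := r + n * m with hRdef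
  set M := r ^ (-(((N : ℝ) - 1) / 2)) * √m with hM
  have hM0 : 0 ≤ M := by positivity
  have hloc : LocallyIntegrable f volume := (Lp.memLp f).locallyIntegrable (by norm_num)
  have hCσ : 0 ≤ C * σ := by positivity
  set B1 : RN N → ℝ := (Metric.ball 0 1).indicator fun x => r ^ κ * ‖x‖ ^ (κ - N) with hB1
  set B2 : RN N → ℝ := (Metric.ball 0 R).indicator fun _ => M ^ Q * R ^ b with hB2
  have hB1_nonneg : ∀ x, 0 ≤ B1 x := fun x => indicator_nonneg (fun x _ => by positivity) x
  have hB2_nonneg : ∀ x, 0 ≤ B2 x := fun x => indicator_nonneg (fun x _ => by positivity) x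
  have hi1 : Integrable B1 := (integrable_indicator_iff Metric.isOpen_ball.measurableSet).2
    ((integrableOn_ball_norm_rpow hN1 hκ).const_mul _)
  have hi2 : Integrable B2 := (integrableOn_const measure_ball_lt_top.ne).integrable_indicator
    Metric.isOpen_ball.measurableSet
  have hi3 : Integrable fun x => ‖f x‖ ^ 2 :=
    (memLp_two_iff_integrable_sq_norm (Lp.aestronglyMeasurable f)).1 (Lp.memLp f)
  have hi12 : Integrable fun x => (C * σ) ^ Q * (B1 x + B2 x) := (hi1.add hi2).const_mul _
  -- One nonnegative summand for each region: `|x| < r`, the shells, and `|x| ≥ R`. The averages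
  -- vanish on the first and the last.
  refine eLpNorm_powerWeight_le (B := fun x => (C * σ) ^ Q * (B1 x + B2 x) +
    (C * σ) ^ (Q - 2) * R ^ (-θ) * ‖f x‖ ^ 2) hq0 hq ?_ (hi12.add
      (hi3.const_mul _)) (by have := shellError_nonneg (N := N) (b := b) (q := Q) (κ := κ) (θ := θ)
                               (n := n) hC hr.le hm; positivity) ?_
  · filter_upwards [hS, ae_all_iff.2 fun j => h.ae_norm_sub_average_le hS hloc hN1 hCσ hr
      (m := m) j] with x hxS hx
    have hx0 : 0 < ‖x‖ := norm_pos_iff.2 (h.ne_zero x hxS)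
    have t3 : 0 ≤ (C * σ) ^ (Q - 2) * R ^ (-θ) * ‖f x‖ ^ 2 := by positivity
    have hp1 : 0 ≤ (C * σ) ^ Q := by positivity
    have t1 := mul_nonneg hp1 (hB1_nonneg x)
    have t2 := mul_nonneg hp1 (hB2_nonneg x)
    by_cases c1 : ‖x‖ < r
    · rw [shellAverage_of_lt hm c1, sub_zero]
      have := rpow_mul_rpow_near_le hCσ hx0 c1.le (norm_nonneg (f x)) (by linarith : 0 ≤ Q) hκ.le
        hα (h.near x hxS (c1.trans_le hr1))
      have e : B1 x = r ^ κ * ‖x‖ ^ (κ - N) :=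
        indicator_of_mem (mem_ball_zero_iff.2 (c1.trans_le hr1)) _
      rw [← e] at this
      linarith
    by_cases c2 : ‖x‖ < R
    · obtain ⟨j, hj, hxj⟩ := exists_mem_shell (not_lt.1 c1) c2
      rw [shellAverage_of_mem hj hxj]
      have h1 := hx j hxj
      rw [mul_assoc] at h1
      have e : B2 x = M ^ Q * R ^ b := indicator_of_mem (mem_ball_zero_iff.2 c2) _
      have : ‖x‖ ^ b * ‖f x - ⨍ y in shell N r m j, f y‖ ^ Q ≤ (C * σ) ^ Q * B2 x := by
        rw [e]
        calc _ ≤ R ^ b * (C * σ * M) ^ Q := by gcongr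
          _ = _ := by rw [Real.mul_rpow hCσ hM0]; ring
      linarith
    · rw [shellAverage_of_ge hm (not_lt.1 c2), sub_zero]
      have := rpow_mul_rpow_neg_le hCσ (by linarith) (not_lt.1 c2) (norm_nonneg (f x)) hq2 hθ.le hβ
        (h.far x hxS (hR.trans (not_lt.1 c2)))
      linarith
  · have hE := shellError_nonneg (N := N) (b := b) (q := Q) (κ := κ) (θ := θ) (n := n) hC hr.le hm
    have i1 : ∫ x, B1 x = r ^ κ * ∫ x in Metric.ball (0 : RN N) 1, ‖x‖ ^ (κ - N) := by
      rw [hB1, integral_indicator Metric.isOpen_ball.measurableSet, integral_const_mul]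
    have i2 : ∫ x, B2 x = M ^ Q * R ^ b * volume.real (Metric.ball (0 : RN N) R) := by
      rw [hB2, integral_indicator Metric.isOpen_ball.measurableSet, setIntegral_const, smul_eq_mul,
        mul_comm]
    -- All terms are homogeneous of degree `Q` in `σ`, so the `Q`-th root is linear in `σ`, as an
    -- operator norm bound requires.
    have hσQ : σ ^ (Q - 2) * σ ^ 2 = σ ^ Q := by
      rcases hσ.eq_or_lt with rfl | hσ
      · rw [Real.zero_rpow (by linarith : Q ≠ 0)]
        simp
      · rw [← Real.rpow_natCast σ 2, ← Real.rpow_add hσ]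
        norm_num
    have hEQ : (shellError N b Q C κ θ r m n ^ (1 / Q) * σ) ^ Q =
        shellError N b Q C κ θ r m n * σ ^ Q := by
      rw [Real.mul_rpow (by positivity) hσ, ← Real.rpow_mul hE, one_div_mul_cancel (by linarith),
        Real.rpow_one]
    rw [integral_add hi12 (hi3.const_mul _), integral_const_mul,
      integral_const_mul, integral_add hi1 hi2, i1, i2, integral_norm_sq_eq_norm_sq,
      ← hQ, hEQ, Real.mul_rpow hC hσ, Real.mul_rpow hC hσ]
    calc _ ≤ C ^ Q * σ ^ Q * (r ^ κ * (∫ x in Metric.ball (0 : RN N) 1, ‖x‖ ^ (κ - N)) +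
          M ^ Q * R ^ b * volume.real (Metric.ball (0 : RN N) R)) +
          C ^ (Q - 2) * σ ^ (Q - 2) * R ^ (-θ) * σ ^ 2 := by gcongr
      _ = shellError N b Q C κ θ r m n * σ ^ Q := by
          rw [shellError, ← hσQ]
          ring

section shellError

variable {N : ℕ} {b q C κ θ : ℝ}

theorem tendsto_shellError_thickness (hq : 0 < q) {r R : ℝ} :
    Tendsto (fun n : ℕ => shellError N b q C κ θ r ((R - r) / (n + 1)) (n + 1)) atTop
      (𝓝 (C ^ q * (r ^ κ * (∫ x in Metric.ball (0 : RN N) 1, ‖x‖ ^ (κ - N))) +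
        C ^ (q - 2) * R ^ (-θ))) := by
  have hR : ∀ n : ℕ, r + ((n + 1 : ℕ) : ℝ) * ((R - r) / (n + 1)) = R := by
    intro n
    push_cast
    field_simp
    ring
  simp only [shellError, hR]
  have h1 : Tendsto (fun n : ℕ => (R - r) / ((n : ℝ) + 1)) atTop (𝓝 0) := by
    have := (tendsto_one_div_add_atTop_nhds_zero_nat (𝕜 := ℝ)).const_mul (R - r)
    simpa [div_eq_mul_inv] using this
  have h2 : Tendsto (fun n : ℕ => (r ^ (-(((N : ℝ) - 1) / 2)) * √((R - r) / (n + 1))) ^ q)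
      atTop (𝓝 0) := by
    have h3 := ((Real.continuous_sqrt.tendsto 0).comp h1).const_mul (r ^ (-(((N : ℝ) - 1) / 2)))
    rw [Real.sqrt_zero, mul_zero] at h3
    have h4 := h3.rpow_const (Or.inr hq.le) (p := q)
    rw [Real.zero_rpow hq.ne'] at h4
    exact h4
  have h3 := ((((h2.mul_const (R ^ b)).mul_const (volume.real (Metric.ball (0 : RN N) R))).const_add
    (r ^ κ * (∫ x in Metric.ball (0 : RN N) 1, ‖x‖ ^ (κ - N)))).const_mul (C ^ q)).add_const
    (C ^ (q - 2) * R ^ (-θ))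
  simpa using h3

/-- The inner radius `r` is fixed first, then the outer radius `R`, and last the number of shells:
with both radii fixed, thinner shells make the middle term vanish. -/
theorem exists_shellError_lt (hq : 0 < q) (hκ : 0 < κ) (hθ : 0 < θ) {ε : ℝ} (hε : 0 < ε) :
    ∃ r m : ℝ, ∃ n : ℕ, 0 < r ∧ r ≤ 1 ∧ 0 ≤ m ∧ 1 ≤ r + n * m ∧
      shellError N b q C κ θ r m n < ε := by
  set I := ∫ x in Metric.ball (0 : RN N) 1, ‖x‖ ^ (κ - N) with hI
  have h1 : Tendsto (fun r : ℝ => C ^ q * (r ^ κ * I)) (𝓝[>] 0) (𝓝 0) := by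
    have : Tendsto (fun r : ℝ => r ^ κ) (𝓝[>] 0) (𝓝 0) := by
      have := (Real.continuousAt_rpow_const 0 κ (Or.inr hκ.le)).tendsto
      rw [Real.zero_rpow hκ.ne'] at this
      exact this.mono_left nhdsWithin_le_nhds
    simpa using (this.mul_const I).const_mul (C ^ q)
  have h2 : Tendsto (fun R : ℝ => C ^ (q - 2) * R ^ (-θ)) atTop (𝓝 0) := by
    simpa using (tendsto_rpow_neg_atTop hθ).const_mul (C ^ (q - 2))
  obtain ⟨r, hr, hr0, hr1⟩ := ((h1.eventually (gt_mem_nhds (half_pos hε))).and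
    (Ioc_mem_nhdsGT one_pos)).exists
  obtain ⟨R, hR, hR1⟩ := ((h2.eventually (gt_mem_nhds (half_pos hε))).and
    (eventually_ge_atTop 1)).exists
  have hlt : C ^ q * (r ^ κ * I) + C ^ (q - 2) * R ^ (-θ) < ε := by linarith
  obtain ⟨n, hn⟩ := ((tendsto_shellError_thickness (N := N) (b := b) (C := C) (κ := κ) (θ := θ) hq
    (r := r) (R := R)).eventually (gt_mem_nhds hlt)).exists
  refine ⟨r, (R - r) / (n + 1), n + 1, hr0, hr1, ?_, ?_, hn⟩
  · have : 0 ≤ R - r := by linarith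
    positivity
  · push_cast
    rw [mul_div_cancel₀ _ (by positivity)]
    linarith

end shellError

/-! ### Shell averaging as a compact operator -/

section operators

variable {N : ℕ} {b : ℝ} {q : ℝ≥0∞} [Fact (1 ≤ q)]

/-- The mean over a shell, as a continuous linear functional on `H¹_r`. -/
noncomputable def shellMean (N : ℕ) (r m : ℝ) (j : ℕ) : H1r N →L[ℂ] ℂ :=
  ((volume.real (shell N r m j))⁻¹ : ℂ) • (innerSL ℂ (indicatorConstLp 2
    (measurableSet_shell (N := N) (r := r) (m := m) j) (volume_shell_lt_top j).ne (1 : ℂ))).comp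
    ((WithLp.fstL 2 ℂ (Lp ℂ 2 (volume : Measure (RN N))) (Lp (CN N) 2 (volume : Measure (RN N)))).comp
      (H1r N).subtypeL)

theorem shellMean_apply (r m : ℝ) (j : ℕ) (u : H1r N) :
    shellMean N r m j u = ⨍ y in shell N r m j, (u : WithLp 2 (Lp ℂ 2 (volume : Measure (RN N)) ×
      Lp (CN N) 2 (volume : Measure (RN N)))).fst y := by
  rw [setAverage_eq, ← L2.inner_indicatorConstLp_one (𝕜 := ℂ)
    (measurableSet_shell (N := N) (r := r) (m := m) j) (volume_shell_lt_top j).ne]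
  simp [shellMean]

theorem powerWeight_shell_ne_top (hb : 0 ≤ b) (r m : ℝ) (j : ℕ) :
    powerWeight N b (shell N r m j) ≠ ⊤ :=
  (powerWeight_lt_top_of_subset_ball hb (shell_subset_ball j)).ne

/-- Averaging over finitely many shells, as an operator from `H¹_r` to `L^q(|x|^b dx)`. -/
noncomputable def shellOperator (N : ℕ) (q : ℝ≥0∞) [Fact (1 ≤ q)] (hb : 0 ≤ b) (r m : ℝ) (n : ℕ) :
    H1r N →L[ℂ] Lp ℂ q (powerWeight N b) :=
  ∑ j ∈ Finset.range n, (shellMean N r m j).smulRight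
    (indicatorConstLp q (measurableSet_shell j) (powerWeight_shell_ne_top hb r m j) (1 : ℂ))

/-- Each summand factors through `ℂ`. -/
theorem isCompactOperator_shellOperator (hb : 0 ≤ b) (r m : ℝ) (n : ℕ) :
    IsCompactOperator (shellOperator N q hb r m n) := by
  refine Submodule.sum_mem (compactOperator (RingHom.id ℂ) (H1r N) (Lp ℂ q (powerWeight N b)))
    fun j _ => ?_
  exact (isCompactOperator_of_locallyCompactSpace_dom (shellMean N r m j)).clm_comp
    (ContinuousLinearMap.toSpanSingleton ℂ (indicatorConstLp q (measurableSet_shell j)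
      (powerWeight_shell_ne_top hb r m j) (1 : ℂ)))

theorem coeFn_shellOperator (hb : 0 ≤ b) (r m : ℝ) (n : ℕ) (u : H1r N) :
    shellOperator N q hb r m n u =ᵐ[powerWeight N b]
      shellAverage r m n (u : WithLp 2 (Lp ℂ 2 (volume : Measure (RN N)) ×
        Lp (CN N) 2 (volume : Measure (RN N)))).fst := by
  rw [shellOperator, _root_.sum_apply]
  refine (Lp.coeFn_finsetSum _ _).trans ?_
  have h1 : ∀ j : ℕ, (shellMean N r m j u • indicatorConstLp q (measurableSet_shell j)
      (powerWeight_shell_ne_top hb r m j) (1 : ℂ) : Lp ℂ q (powerWeight N b)) =ᵐ[powerWeight N b]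
      (shell N r m j).indicator fun _ => shellMean N r m j u := by
    intro j
    filter_upwards [Lp.coeFn_smul (shellMean N r m j u) (indicatorConstLp q (measurableSet_shell j)
      (powerWeight_shell_ne_top hb r m j) (1 : ℂ)), indicatorConstLp_coeFn (p := q)
      (hs := measurableSet_shell j) (hμs := powerWeight_shell_ne_top hb r m j) (c := (1 : ℂ))]
      with x h1 h2
    rw [h1, Pi.smul_apply, h2]
    by_cases hx : x ∈ shell N r m j <;> simp [hx]
  filter_upwards [ae_all_iff.2 h1] with x hx
  rw [Finset.sum_apply]
  refine Finset.sum_congr rfl fun j _ => ?_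
  rw [ContinuousLinearMap.smulRight_apply, hx j, shellMean_apply]

end operators

/-! ### Uniqueness of weak gradients, exponents, and the embedding -/

/-- The weak gradient of the zero function is zero. -/
theorem IsWeakGradient.eq_zero {N : ℕ} {g : Lp (CN N) 2 (volume : Measure (RN N))}
    (h : IsWeakGradient 0 g) : g = 0 := by
  have hi : ∀ i : Fin N, ∀ᵐ x, (g x) i = 0 := by
    intro i
    have hg : LocallyIntegrable (fun x => (g x) i) volume := by
      have : MemLp (fun x => (g x) i) 2 volume :=
        (EuclideanSpace.proj (𝕜 := ℂ) i : CN N →L[ℂ] ℂ).comp_memLp' (Lp.memLp g)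
      exact this.locallyIntegrable (by norm_num)
    refine ae_eq_zero_of_integral_contDiff_smul_eq_zero hg fun φ h1 h2 => ?_
    have e := h φ h1 h2 i
    have : ∫ x, (fderiv ℝ φ x (EuclideanSpace.single i 1)) •
        (0 : Lp ℂ 2 (volume : Measure (RN N))) x = 0 := by simp
    rw [this] at e
    exact neg_eq_zero.1 e.symm
  refine Lp.ext ?_
  filter_upwards [ae_all_iff.2 hi, Lp.coeFn_zero (CN N) 2 (volume : Measure (RN N))] with x hx h0
  rw [h0]
  ext i
  simpa using hx i

/-- The lower bound on `p` is equivalent to `θ > 0`. The upper bound is equivalent to positivity of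
the gap `b + N - (N-2)(p+1)/2`, which for `N = 2` is just `b + 2`. -/
theorem exists_embedding_exponents {N : ℕ} (hN : 2 ≤ N) {b p : ℝ} (hb : 0 < b)
    (hp : 1 + 2 * b / ((N : ℝ) - 1) < p)
    (hp' : 3 ≤ N → p < ((N : ℝ) + 2 + 2 * b) / ((N : ℝ) - 2)) :
    1 < p ∧ ∃ δ κ θ : ℝ, 0 < δ ∧ 0 < κ ∧ 0 < θ ∧
      b - ((N : ℝ) - 2 + δ) / 2 * (p + 1) = 2 * κ - N ∧
      ((N : ℝ) - 1) / 2 * (p + 1 - 2) = b + θ := by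
  have hN' : (2 : ℝ) ≤ N := by exact_mod_cast hN
  have hN1 : (0 : ℝ) < N - 1 := by linarith
  have hp1 : 1 < p := by
    have : 0 < 2 * b / ((N : ℝ) - 1) := by positivity
    linarith
  have hg : 0 < b + N - ((N : ℝ) - 2) / 2 * (p + 1) := by
    rcases hN.eq_or_lt with rfl | h3
    · push_cast
      linarith
    · have h3' : (3 : ℝ) ≤ N := by exact_mod_cast h3
      have := hp' h3
      rw [lt_div_iff₀ (by linarith)] at this
      linarith
  have hθ : 0 < ((N : ℝ) - 1) / 2 * (p + 1 - 2) - b := by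
    have h1 : 2 * b / ((N : ℝ) - 1) < p - 1 := by linarith
    rw [div_lt_iff₀ hN1] at h1
    linarith
  -- Half of the gap pays for `δ (p + 1) / 2`; the remaining half is `2 κ`.
  refine ⟨hp1, (b + N - ((N : ℝ) - 2) / 2 * (p + 1)) / (p + 1),
    (b + N - ((N : ℝ) - 2) / 2 * (p + 1)) / 4, _, ?_, ?_, hθ, ?_, ?_⟩
  · have : 0 < p + 1 := by linarith
    positivity
  · positivity
  · have : p + 1 ≠ 0 := by linarith
    field_simp
    ring
  · ring

section abstractEmbedding

variable {E : Type*} [NormedAddCommGroup E] [NormedSpace ℂ E]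

theorem isCompactOperator_of_forall_exists_norm_sub_le {F : Type*} [NormedAddCommGroup F]
    [NormedSpace ℂ F] [CompleteSpace F] (T : E →L[ℂ] F)
    (h : ∀ ε > 0, ∃ P : E →L[ℂ] F, IsCompactOperator P ∧ ∀ u, ‖T u - P u‖ ≤ ε * ‖u‖) :
    IsCompactOperator T := by
  choose P hP hPT using fun n : ℕ => h (1 / ((n : ℝ) + 1)) (by positivity)
  refine isCompactOperator_of_tendsto (l := atTop) (F := P) ?_ (.of_forall hP)
  rw [tendsto_iff_norm_sub_tendsto_zero]
  refine squeeze_zero (fun _ => norm_nonneg _) (fun n => ?_)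
    tendsto_one_div_add_atTop_nhds_zero_nat
  rw [norm_sub_rev]
  exact ContinuousLinearMap.opNorm_le_bound _ (by positivity) (hPT n)

/-- An a priori bound for the weighted `L^q` norm on a subspace of `L²` yields an inclusion of this
subspace in the weighted `L^q` space. -/
theorem exists_inclusion_of_eLpNorm_le {N : ℕ} (hN : 1 ≤ N) {b K : ℝ} {q : ℝ≥0∞} [Fact (1 ≤ q)]
    (hK : 0 ≤ K) (T : E →L[ℂ] Lp ℂ 2 (volume : Measure (RN N)))
    (h : ∀ u, eLpNorm (T u) q (powerWeight N b) ≤ ENNReal.ofReal (K * ‖u‖)) :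
    ∃ ι : E →L[ℂ] Lp ℂ q (powerWeight N b), ∀ u, ι u =ᵐ[volume] T u := by
  have hmem : ∀ u, MemLp (T u) q (powerWeight N b) := fun u =>
    ⟨(Lp.aestronglyMeasurable (T u)).mono_ac (withDensity_absolutelyContinuous _ _),
      (h u).trans_lt ENNReal.ofReal_lt_top⟩
  let L : E →ₗ[ℂ] Lp ℂ q (powerWeight N b) :=
    { toFun := fun u => (hmem u).toLp _
      map_add' := fun u v => by
        rw [← MemLp.toLp_add]
        refine MemLp.toLp_congr _ _ ((ae_powerWeight_iff hN).2 ?_)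
        rw [map_add]
        exact Lp.coeFn_add _ _
      map_smul' := fun c u => by
        rw [RingHom.id_apply, ← MemLp.toLp_const_smul]
        refine MemLp.toLp_congr _ _ ((ae_powerWeight_iff hN).2 ?_)
        rw [map_smul]
        exact Lp.coeFn_smul _ _ }
  have hL : ∀ u, ‖L u‖ ≤ K * ‖u‖ := fun u => by
    change ‖(hmem u).toLp _‖ ≤ _
    rw [Lp.norm_toLp]
    exact ENNReal.toReal_le_of_le_ofReal (mul_nonneg hK (norm_nonneg u)) (h u)
  exact ⟨L.mkContinuous K hL, fun u => (ae_powerWeight_iff hN).1 (hmem u).coeFn_toLp⟩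

end abstractEmbedding

theorem norm_sub_le_of_ae_eq {N : ℕ} (hN : 1 ≤ N) {b K : ℝ} {q : ℝ≥0∞} [Fact (1 ≤ q)]
    (hK : 0 ≤ K) {v w : Lp ℂ q (powerWeight N b)} {f g : RN N → ℂ} (hv : v =ᵐ[volume] f)
    (hw : w =ᵐ[powerWeight N b] g)
    (h : eLpNorm (fun x => f x - g x) q (powerWeight N b) ≤ ENNReal.ofReal K) : ‖v - w‖ ≤ K := by
  rw [Lp.norm_def]
  refine ENNReal.toReal_le_of_le_ofReal hK (le_trans (le_of_eq (eLpNorm_congr_ae ?_)) h)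
  filter_upwards [Lp.coeFn_sub v w, (ae_powerWeight_iff hN).2 hv, hw] with x h1 h2 h3
  rw [h1, Pi.sub_apply, h2, h3]

/-- The map taking an element of `H¹_r`, a pair `(f, ∇f)`, to the function `f`. -/
noncomputable def H1rFst (N : ℕ) : H1r N →L[ℂ] Lp ℂ 2 (volume : Measure (RN N)) :=
  (WithLp.fstL 2 ℂ (Lp ℂ 2 (volume : Measure (RN N))) (Lp (CN N) 2 (volume : Measure (RN N)))).comp
    (H1r N).subtypeL

theorem H1rFst_apply {N : ℕ} (u : H1r N) : H1rFst N u = (u : WithLp 2 (Lp ℂ 2 (volume : Measure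
    (RN N)) × Lp (CN N) 2 (volume : Measure (RN N)))).fst := rfl

theorem norm_H1rFst_le {N : ℕ} (u : H1r N) : ‖H1rFst N u‖ ≤ ‖u‖ := by
  refine le_of_sq_le_sq ?_ (norm_nonneg u)
  rw [Submodule.coe_norm, WithLp.prod_norm_sq_eq_of_L2]
  exact le_add_of_nonneg_right (sq_nonneg _)

/-- Elements are pairs `(f, ∇f)`, so this is uniqueness of the weak gradient. -/
theorem injective_H1rFst (N : ℕ) : Function.Injective (H1rFst N) := by
  rw [injective_iff_map_eq_zero]
  intro u hu
  have hg : IsWeakGradient (H1rFst N u) (u : WithLp 2 (Lp ℂ 2 (volume : Measure (RN N)) ×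
      Lp (CN N) 2 (volume : Measure (RN N)))).snd := u.2.1
  rw [hu] at hg
  exact Subtype.ext (WithLp.ofLp_injective 2 (Prod.ext hu hg.eq_zero))

theorem injective_of_ae_eq_H1rFst {N : ℕ} {b : ℝ} {q : ℝ≥0∞} [Fact (1 ≤ q)]
    {ι : H1r N →L[ℂ] Lp ℂ q (powerWeight N b)} (hι : ∀ u, ι u =ᵐ[volume] H1rFst N u) :
    Function.Injective ι := by
  intro u v huv
  refine injective_H1rFst N (Lp.ext ?_)
  refine (hι u).symm.trans (EventuallyEq.trans ?_ (hι v))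
  rw [huv]

/-- Shell averages approximate the functions of `H¹_r` in `L^q(|x|^b dx)`, for admissible `q`. -/
theorem exists_eLpNorm_H1rFst_sub_shellAverage_le {N : ℕ} (hN : 2 ≤ N) {b δ κ θ : ℝ} {q : ℝ≥0∞}
    (hb : 0 < b) (hq : q ≠ ⊤) (hq2 : 2 < q.toReal) (hδ : 0 < δ) (hκ : 0 < κ) (hθ : 0 < θ)
    (hα : b - ((N : ℝ) - 2 + δ) / 2 * q.toReal = 2 * κ - N)
    (hβ : ((N : ℝ) - 1) / 2 * (q.toReal - 2) = b + θ) :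
    ∃ C : ℝ, 0 ≤ C ∧ ∀ (r m : ℝ) (n : ℕ), 0 < r → r ≤ 1 → 0 ≤ m → 1 ≤ r + n * m → ∀ u : H1r N,
      eLpNorm (fun x => H1rFst N u x - shellAverage r m n (H1rFst N u) x) q (powerWeight N b) ≤
        ENNReal.ofReal (shellError N b q.toReal C κ θ r m n ^ (1 / q.toReal) * ‖u‖) := by
  obtain ⟨C, hC, hbd⟩ := exists_radialBounds hN hδ
  refine ⟨C, hC.le, fun r m n hr hr1 hm hR u => ?_⟩
  obtain ⟨S, hS, hSb⟩ := hbd u.1 u.2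
  rw [← H1rFst_apply u, ← Submodule.coe_norm] at hSb
  exact eLpNorm_sub_shellAverage_le hN hb hq hq2 hκ hθ hα hβ hC.le (norm_nonneg u)
    (norm_H1rFst_le u) hS hSb hr hr1 hm hR

set_option maxHeartbeats 1000000 in
theorem exists_compact_inclusion {N : ℕ} (hN : 2 ≤ N) {b δ κ θ : ℝ} {q : ℝ≥0∞} [Fact (1 ≤ q)]
    (hb : 0 < b) (hq : q ≠ ⊤) (hq2 : 2 < q.toReal) (hδ : 0 < δ) (hκ : 0 < κ) (hθ : 0 < θ)
    (hα : b - ((N : ℝ) - 2 + δ) / 2 * q.toReal = 2 * κ - N)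
    (hβ : ((N : ℝ) - 1) / 2 * (q.toReal - 2) = b + θ) :
    ∃ ι : H1r N →L[ℂ] Lp ℂ q (powerWeight N b),
      (∀ u, ι u =ᵐ[volume] H1rFst N u) ∧ IsCompactOperator ι := by
  have hN1 : 1 ≤ N := by omega
  obtain ⟨C, hC, key⟩ := exists_eLpNorm_H1rFst_sub_shellAverage_le hN hb hq hq2 hδ hκ hθ hα hβ
  have hnonneg : ∀ {r m : ℝ} {n : ℕ}, 0 < r → 0 ≤ m →
      0 ≤ shellError N b q.toReal C κ θ r m n ^ (1 / q.toReal) := fun hr hm =>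
    Real.rpow_nonneg (shellError_nonneg hC hr.le hm) _
  -- With `r = 1` and no shells the average is zero, and the approximation estimate becomes the a
  -- priori bound.
  obtain ⟨ι, hι⟩ := exists_inclusion_of_eLpNorm_le (b := b) (q := q) hN1
    (hnonneg (n := 0) one_pos le_rfl) (H1rFst N)
    fun u => by simpa [shellAverage] using key 1 0 0 one_pos le_rfl le_rfl (by simp) u
  refine ⟨ι, hι, isCompactOperator_of_forall_exists_norm_sub_le ι fun ε hε => ?_⟩
  -- The target is `ε ^ q` because the error enters through its `q`-th root.
  obtain ⟨r, m, n, hr, hr1, hm, hR, hE⟩ := exists_shellError_lt (N := N) (b := b) (C := C)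
    (κ := κ) (θ := θ) (q := q.toReal) (by linarith) hκ hθ (Real.rpow_pos_of_pos hε q.toReal)
  refine ⟨shellOperator N q hb.le r m n, isCompactOperator_shellOperator hb.le r m n, fun u => ?_⟩
  have hKε : shellError N b q.toReal C κ θ r m n ^ (1 / q.toReal) ≤ ε := by
    rw [one_div]
    exact (Real.rpow_inv_le_iff_of_pos (shellError_nonneg hC hr.le hm) hε.le (by linarith)).2 hE.le
  refine (norm_sub_le_of_ae_eq hN1 (mul_nonneg (hnonneg hr hm) (norm_nonneg u)) (hι u)
    (coeFn_shellOperator hb.le r m n u) ?_).trans (mul_le_mul_of_nonneg_right hKε (norm_nonneg u))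
  rw [← H1rFst_apply u]
  exact key r m n hr hr1 hm hR u

theorem lemma2p6 (N : ℕ) (hN : 2 ≤ N) (b p : ℝ) (hb : 0 < b)
    (hp : 1 + 2 * b / ((N : ℝ) - 1) < p)
    (hp' : 3 ≤ N → p < ((N : ℝ) + 2 + 2 * b) / ((N : ℝ) - 2)) :
    ∃ ι : H1r N →L[ℂ] Lp ℂ (ENNReal.ofReal p + 1) (powerWeight N b),
      (∀ u : H1r N, ι u =ᵐ[volume] (u : WithLp 2 (Lp ℂ 2 (volume : Measure (RN N)) ×
        Lp (CN N) 2 (volume : Measure (RN N)))).fst) ∧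
      Function.Injective ι ∧ IsCompactOperator ι := by
  obtain ⟨hp1, δ, κ, θ, hδ, hκ, hθ, hα, hβ⟩ := exists_embedding_exponents hN hb hp hp'
  have hQ : (ENNReal.ofReal p + 1).toReal = p + 1 := by
    rw [ENNReal.toReal_add (by simp) (by simp), ENNReal.toReal_ofReal (by linarith)]
    simp
  rw [← hQ] at hα hβ
  obtain ⟨ι, hι, hc⟩ := exists_compact_inclusion (q := ENNReal.ofReal p + 1) hN hb (by simp)
    (by linarith) hδ hκ hθ hα hβ
  exact ⟨ι, fun u => by rw [← H1rFst_apply u]; exact hι u, injective_of_ae_eq_H1rFst hι, hc⟩
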